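/- **Problems.** An elastic-degenerate (ED) string is a sequence $\tilde T=\tilde T[1]\cdots\tilde T[n]$ of finite non-empty sets of strings; $n$ is its length and its size $N$ is the total length of all strings in all the sets. A string $P$ matches an ED string $\tilde X$ if either $|\tilde X|=1$ and $P$ is a substring of some string in $\tilde X[1]$, or $|\tilde X|>1$ and $P=P_1\cdots P_{|\tilde X|}$ where $P_1$ is a non-empty suffix of some string in $\tilde X[1]$, $P_{|\tilde X|}$ is a non-empty prefix of some string in $\tilde X[|\tilde X|]$, and $P_i\in\tilde X[i]$ for $1<i<|\tilde X|$. Elastic-degenerate string matching (EDSM): given a non-empty pattern $P$ of length $m$ and an ED string $\tilde T$ of length $n$ and size $N\ge m$, decide for every position $j\in\{1,\dots,n\}$ whether $P$ matches $\tilde T[i]\cdots\tilde T[j]$ for some $i\le j$. Triangle detection (TD): given Boolean matrices $A,B,C$ of order $\mathcal N\times\mathcal N$, $\mathcal N\ge1$, decide whether there are $i,j,k$ with $A[i,j]=B[j,k]=C[k,i]=1$. **Algorithms.** Algorithms are programs of a word RAM with words of $w$ bits, which have to be correct and meet their time bound whenever $w\ge\kappa\log_2(\text{input size})$, for some constant $\kappa$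 of the algorithm (the input size accounts also for the largest letter). Inputs are groups of strings of numbers with random access to every letter. Since "combinatorial" has no formal definition, the result is stated relative to an arbitrary set $\mathcal S$ of programs that are granted to be combinatorial: the *combinatorial* algorithms are those in $\mathcal S$ and, recursively, those which transform their input by a word RAM program computing a *local* map (the lengths of all strings of the result depend only on the lengths of the strings of the argument and, for given lengths, each letter of the result is determined by a single letter of the argument), run a combinatorial algorithm on the result, and output the disjunction of its output bits. The time of the transformation counts. **Theorem.** For every $\mathcal S$ and every $\varepsilon>0$: if EDSM can be solved in $\mathcal O(n\,m^{1.5-\varepsilon}+N)$ time by a combinatorial algorithm, then there is a truly subcubic combinatorial algorithm for TD, i.e. one that solves TD in $\mathcal O(\mathcal N^{3-\delta})$ time for some $\delta>0$. -/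

import Mathlib

namespace EDSM

/-! ### Word RAM programs

The memory of the machine consists of banks, each an array of words addressed by words. A program
mentions finitely many banks. Words are natural numbers below `2 ^ w`, where `w` is the word size;
every elementary operation costs one step. -/

/-- Binary operations on words. -/
inductive Op where
  | add | sub | mul | div | mod | and | or | xor | shl | shr | lt | eq

/-- The value of an operation at word size `w` (arithmetic is modulo `2 ^ w`). -/
def Op.eval (w : ℕ) : Op → ℕ → ℕ → ℕ
  | .add, a, b => (a + b) % 2 ^ w
  | .sub, a, b => (a + (2 ^ w - b)) % 2 ^ w
  | .mul, a, b => (a * b) % 2 ^ w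
  | .div, a, b => (a / b) % 2 ^ w
  | .mod, a, b => (a % b) % 2 ^ w
  | .and, a, b => (a &&& b) % 2 ^ w
  | .or, a, b => (a ||| b) % 2 ^ w
  | .xor, a, b => (a ^^^ b) % 2 ^ w
  | .shl, a, b => (a <<< b) % 2 ^ w
  | .shr, a, b => (a >>> b) % 2 ^ w
  | .lt, a, b => (if a < b then 1 else 0) % 2 ^ w
  | .eq, a, b => (if a = b then 1 else 0) % 2 ^ w

/-- A memory: `σ b a` is the word at address `a` of bank `b`. -/
abbrev Mem := ℕ → ℕ → ℕ

/-- Expressions: constants, reading a cell of a bank, binary operations. -/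
inductive Expr where
  | const (c : ℕ)
  | load (b : ℕ) (addr : Expr)
  | bin (o : Op) (e₁ e₂ : Expr)

/-- The value of an expression. -/
def Expr.eval (w : ℕ) (σ : Mem) : Expr → ℕ
  | .const c => c % 2 ^ w
  | .load b e => σ b (e.eval w σ)
  | .bin o e₁ e₂ => o.eval w (e₁.eval w σ) (e₂.eval w σ)

/-- The number of steps that evaluating an expression takes. -/
def Expr.cost : Expr → ℕ
  | .const _ => 1
  | .load _ e => e.cost + 1
  | .bin _ e₁ e₂ => e₁.cost + e₂.cost + 1

/-- Programs; tests succeed on nonzero words. -/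
inductive Prog where
  | skip
  | store (b : ℕ) (addr val : Expr)
  | seq (p q : Prog)
  | ite (c : Expr) (p q : Prog)
  | while (c : Expr) (p : Prog)

/-- `Exec w p σ σ' t`: at word size `w`, the program `p` started in the memory `σ` halts
after exactly `t` steps in the memory `σ'`. -/
inductive Exec (w : ℕ) : Prog → Mem → Mem → ℕ → Prop
  | skip (σ : Mem) : Exec w .skip σ σ 1
  | store (σ : Mem) (b : ℕ) (e₁ e₂ : Expr) :
      Exec w (.store b e₁ e₂) σ
        (Function.update σ b (Function.update (σ b) (e₁.eval w σ) (e₂.eval w σ)))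
        (e₁.cost + e₂.cost + 1)
  | seq {p q : Prog} {σ σ₁ σ₂ : Mem} {t₁ t₂ : ℕ} :
      Exec w p σ σ₁ t₁ → Exec w q σ₁ σ₂ t₂ → Exec w (.seq p q) σ σ₂ (t₁ + t₂)
  | iteTrue {c : Expr} {p q : Prog} {σ σ' : Mem} {t : ℕ} :
      c.eval w σ ≠ 0 → Exec w p σ σ' t → Exec w (.ite c p q) σ σ' (c.cost + 1 + t)
  | iteFalse {c : Expr} {p q : Prog} {σ σ' : Mem} {t : ℕ} :
      c.eval w σ = 0 → Exec w q σ σ' t → Exec w (.ite c p q) σ σ' (c.cost + 1 + t)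
  | whileTrue {c : Expr} {p : Prog} {σ σ₁ σ₂ : Mem} {t₁ t₂ : ℕ} :
      c.eval w σ ≠ 0 → Exec w p σ σ₁ t₁ → Exec w (.while c p) σ₁ σ₂ t₂ →
      Exec w (.while c p) σ σ₂ (c.cost + 1 + t₁ + t₂)
  | whileFalse {c : Expr} {p : Prog} {σ : Mem} :
      c.eval w σ = 0 → Exec w (.while c p) σ σ (c.cost + 1)

/-! ### Input and output -/

/-- Inputs of all problems: a list of groups, each an array of strings of numbers. -/
abbrev Data := List (List (List ℕ))

/-- All letters of an input, in order. -/
def letters (x : Data) : List ℕ := x.flatten.flatten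

/-- The shape of an input: the lengths of the strings of each group. -/
def shape (x : Data) : List (List ℕ) := x.map fun g => g.map List.length

/-- The initial memory on input `x`. Bank 0 holds the letters; bank 1 the position of the first
letter of each string; bank 2 the number of the first string of each group (both with a final
entry for the end); bank 3 the numbers of groups, strings and letters. Everything else is 0. -/
def enc (x : Data) : Mem := fun b a =>
  match b with
  | 0 => (letters x).getD a 0
  | 1 => if a ≤ x.flatten.length then (x.flatten.take a).flatten.length else 0
  | 2 => if a ≤ x.length then (x.take a).flatten.length else 0
  | 3 => [x.length, x.flatten.length, (letters x).length].getD a 0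
  | _ => 0

/-- The size of an input: it bounds the number of groups, strings and letters and the letters. -/
def dataSize (x : Data) : ℕ :=
  x.length + x.flatten.length + (letters x).length + (letters x).foldr max 0 + 2

/-- Words have at least `κ * log₂ (size of the input)` bits. -/
def Fits (κ w : ℕ) (x : Data) : Prop := dataSize x ^ κ ≤ 2 ^ w

/-- The output is a bit vector of length `n` whose `j`-th bit (from `j = 0` on) says whether `p j`
holds: bank 4 holds its length, followed by its bits (nonzero for true). -/
def Outputs (σ : Mem) (n : ℕ) (p : ℕ → Prop) : Prop :=
  σ 4 0 = n ∧ ∀ j < n, (σ 4 (j + 1) ≠ 0 ↔ p j)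

/-! ### Elastic-degenerate string matching -/

/-- The pattern `P` matches the ED string `X` (a list of sets of strings, given as arrays). -/
def Matches {α : Type*} (P : List α) (X : List (List (List α))) : Prop :=
  (∃ S, X = [S] ∧ ∃ u ∈ S, P <:+: u) ∨
  ∃ S Y S', X = S :: (Y ++ [S']) ∧ ∃ p qs p', P = p ++ qs.flatten ++ p' ∧ p ≠ [] ∧ p' ≠ [] ∧
    (∃ u ∈ S, p <:+ u) ∧ List.Forall₂ (fun q R => q ∈ R) qs Y ∧ (∃ u ∈ S', p' <+: u)

/-- An occurrence of `P` ends at the `j`-th segment of `T` (segments are counted from 0). -/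
def OccEndsAt {α : Type*} (P : List α) (T : List (List (List α))) (j : ℕ) : Prop :=
  j < T.length ∧ ∃ i ≤ j, Matches P ((T.take (j + 1)).drop i)

/-- The size of an ED string: the total length of all strings in it. -/
def textSize {α : Type*} (T : List (List (List α))) : ℕ := T.flatten.flatten.length

/-- Instances of EDSM: a nonempty pattern, and a text whose segments are finite nonempty sets
(listed without repetition), of size at least the length of the pattern. -/
def IsInstance {α : Type*} (P : List α) (T : List (List (List α))) : Prop :=
  P ≠ [] ∧ (∀ S ∈ T, S ≠ [] ∧ S.Nodup) ∧ P.length ≤ textSize T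

/-- `M` solves EDSM in time `O(τ m n N)`, where `m` is the length of the pattern and `n` and `N`
are the length and the size of the text. -/
def SolvesEDSM (M : Prog) (τ : ℕ → ℕ → ℕ → ℝ) : Prop :=
  ∃ (K : ℝ) (κ : ℕ), ∀ (P : List ℕ) (T : Data), IsInstance P T →
    ∀ w, Fits κ w ([P] :: T) → ∃ σ t, Exec w M (enc ([P] :: T)) σ t ∧
      Outputs σ T.length (OccEndsAt P T) ∧ (t : ℝ) ≤ K * τ P.length T.length (textSize T)

/-! ### Triangle detection -/

/-- The rows of a Boolean matrix. -/
def rows {n : ℕ} (A : Matrix (Fin n) (Fin n) Bool) : List (List ℕ) :=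
  List.ofFn fun i => List.ofFn fun j => (A i j).toNat

/-- `M` solves triangle detection on `n × n` matrices, `n ≥ 1`, in time `O(τ n)`. -/
def SolvesTD (M : Prog) (τ : ℕ → ℝ) : Prop :=
  ∃ (K : ℝ) (κ : ℕ), ∀ (n : ℕ) (A B C : Matrix (Fin n) (Fin n) Bool), 1 ≤ n →
    ∀ w, Fits κ w [rows A, rows B, rows C] →
      ∃ σ t, Exec w M (enc [rows A, rows B, rows C]) σ t ∧
        Outputs σ 1 (fun _ => ∃ i j k, A i j = true ∧ B j k = true ∧ C k i = true) ∧
        (t : ℝ) ≤ K * τ n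

/-- `M` is a truly subcubic algorithm for triangle detection. -/
def IsTrulySubcubicTD (M : Prog) : Prop :=
  ∃ δ : ℝ, 0 < δ ∧ SolvesTD M fun n => (n : ℝ) ^ (3 - δ)

/-! ### Combinatorial algorithms

Which algorithms are combinatorial is a matter of convention: any set `𝒮` of programs may be taken
as the stock of combinatorial ones. What is derived from them may only be preprocessed by maps each
of whose output letters is determined by a single input letter (so the preprocessing cannot add,
multiply or otherwise combine matrix entries), and postprocessed by taking a disjunction. -/

/-- A map of inputs is local if the shape of the result depends only on the shape of the argument
and, for each shape, every letter of the result depends on a single letter of the argument. -/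
def IsLocal (f : Data → Data) : Prop :=
  (∀ x y, shape x = shape y → shape (f x) = shape (f y)) ∧
  ∀ (s : List (List ℕ)) (q : ℕ), ∃ p, ∀ x y, shape x = s → shape y = s →
    (letters x).getD p 0 = (letters y).getD p 0 →
    (letters (f x)).getD q 0 = (letters (f y)).getD q 0

/-- `R` turns every input `x` into the input `f x` for a program that lives in the banks from `k`
on, if the word size is large enough. -/
def Transforms (R : Prog) (k : ℕ) (f : Data → Data) : Prop :=
  ∃ κ : ℕ, ∀ x w, Fits κ w x →
    ∃ σ t, Exec w R (enc x) σ t ∧ ∀ b a, σ (k + b) a = enc (f x) b a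

/-- Renaming bank `b` to `k + b` in an expression. -/
def Expr.shift (k : ℕ) : Expr → Expr
  | .const c => .const c
  | .load b e => .load (k + b) (e.shift k)
  | .bin o e₁ e₂ => .bin o (e₁.shift k) (e₂.shift k)

/-- Renaming bank `b` to `k + b` in a program. -/
def Prog.shift (k : ℕ) : Prog → Prog
  | .skip => .skip
  | .store b e₁ e₂ => .store (k + b) (e₁.shift k) (e₂.shift k)
  | .seq p q => .seq (p.shift k) (q.shift k)
  | .ite c p q => .ite (c.shift k) (p.shift k) (q.shift k)
  | .while c p => .while (c.shift k) (p.shift k)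

/-- Outputs the single bit that is the disjunction of the bit vector which the program that lives
in the banks from `k` on has put out (in bank `k + 4`, with its length in cell 0). -/
def disjunction (k : ℕ) : Prog :=
  let len := Expr.load (k + 4) (.const 0)
  .seq (.store 4 (.const 0) (.const 1)) <|
  .seq (.store 4 (.const 1) (.const 0)) <|
  .while len <|
    .seq (.ite (.load (k + 4) len) (.store 4 (.const 1) (.const 1)) .skip)
      (.store (k + 4) (.const 0) (.bin .sub len (.const 1)))

/-- Run `R`, then `M` in the banks from `k` on, then take the disjunction of the output of `M`. -/
def reduceTo (k : ℕ) (R M : Prog) : Prog := .seq R (.seq (M.shift k) (disjunction k))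

/-- The combinatorial algorithms relative to the stock `𝒮`: those in `𝒮`, and those that run a
combinatorial algorithm on a locally transformed input and output the disjunction of its output
bits. -/
inductive Combinatorial (𝒮 : Set Prog) : Prog → Prop
  | base {M : Prog} : M ∈ 𝒮 → Combinatorial 𝒮 M
  | reduce {R M : Prog} {k : ℕ} {f : Data → Data} : 5 ≤ k → IsLocal f → Transforms R k f →
      Combinatorial 𝒮 M → Combinatorial 𝒮 (reduceTo k R M)

end EDSM

/-! A triangle is found by choosing one string from each of three consecutive segments. Fix `q ≥ 3`
with `2 / q ≤ ε`, let `r` be least with `n ≤ r ^ q`, pad the matrices with zeros to order `r ^ q`,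
and cut the index range into `r` blocks of length `b = r ^ (q - 1)`. The pattern has a piece for
every row `i` and every two blocks `J`, `K`: the letter `(i, J)`, `b` zeros, the letter `(J, K)`,
`b` zeros, the letter `(i, K)`. The entries `A i j`, `B j k`, `C k i` contribute the letter `(i, J)`
followed by `j % b` zeros; `b - j % b` zeros, the letter `(J, K)`, `k % b` zeros; and `b - k % b`
zeros followed by `(i, K)`, where `J = j / b` and `K = k / b`. Three such strings form a piece
exactly when they come from a triangle: the letters compare rows and blocks, the zeros compare
offsets in unary (`triangle_of_eq`, `eq_of_triangle`). So the pattern need not list the offsets and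
stays short.

All other pieces have to be absorbed by the text. Segments with aligned chunks of `r ^ t` pieces and
the empty string, `r` copies for each `t`, skip any number of pieces digit by digit in base `r`
(`spells_skipBefore`, `spells_skipAfter`). The end letters 4 and 8 force an occurrence to use the
whole text (`exists_occEndsAt_iff`), and `spells_core_iff` concludes correctness.

The text has `O(r)` segments and size `O(r ^ (3 * q - 1))`, the pattern has length `O(r ^ (2 * q +
1))`. By the choice of `q` both terms of the assumed time bound are `O(r ^ (3 * q - 1))`, which is
`O(n ^ (3 - 1 / q))` (`length_pattern_rpow_le`, `solvesTD_reduceTo`).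

The instance must also be produced by a word RAM program computing a local map. It is described by a
generator, a fixed nest of loops, which compiles to a program running in time proportional to its
work (`Gen.compile_exec`) without overflow (`Gen.exists_safe`). Locality (`isLocal_templateMap`)
forbids dropping the strings of zero entries; they carry a letter that does not occur in the pattern
instead. -/

namespace EDSM

/-! ### A language of generators

A generator describes the letters, ends of strings and ends of groups of an output by means of
bounded loops over natural numbers. Only its letters may depend on the input, each on one cell. -/

/-- Operations on natural numbers. -/
inductive ArithOp where
  | add | sub | mul | div | mod | lt

/-- The value of an operation. -/
def ArithOp.eval : ArithOp → ℕ → ℕ → ℕ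
  | .add, a, b => a + b
  | .sub, a, b => a - b
  | .mul, a, b => a * b
  | .div, a, b => a / b
  | .mod, a, b => a % b
  | .lt, a, b => if a < b then 1 else 0

/-- Arithmetic expressions in variables, which are numbered from the outermost one on. -/
inductive Arith where
  | var (v : ℕ)
  | const (c : ℕ)
  | bin (o : ArithOp) (e₁ e₂ : Arith)

/-- The value of an expression; variables beyond the environment are zero. -/
def Arith.eval (env : List ℕ) : Arith → ℕ
  | .var v => env.getD v 0
  | .const c => c
  | .bin o e₁ e₂ => o.eval (e₁.eval env) (e₂.eval env)

/-- All intermediate values of an expression are below `M`. -/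
def Arith.Safe (M : ℕ) (env : List ℕ) : Arith → Prop
  | .var v => v < M ∧ env.getD v 0 < M
  | .const c => c < M
  | .bin o e₁ e₂ => e₁.Safe M env ∧ e₂.Safe M env ∧ o.eval (e₁.eval env) (e₂.eval env) < M

/-- The operation as an expression of the machine. -/
def ArithOp.compile : ArithOp → Expr → Expr → Expr
  | .add, a, b => .bin .add a b
  -- Machine subtraction wraps around; the factor `b < a` makes it truncated.
  | .sub, a, b => .bin .mul (.bin .sub a b) (.bin .lt b a)
  | .mul, a, b => .bin .mul a b
  | .div, a, b => .bin .div a b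
  | .mod, a, b => .bin .mod a b
  | .lt, a, b => .bin .lt a b

/-- The expression of the machine, where `d` variables are stored in bank 5. -/
def Arith.compile (d : ℕ) : Arith → Expr
  | .var v => if v < d then .load 5 (.const v) else .const 0
  | .const c => .const c
  | .bin o e₁ e₂ => o.compile (e₁.compile d) (e₂.compile d)

theorem Arith.Safe.lt {M : ℕ} {env : List ℕ} {e : Arith} (h : e.Safe M env) : e.eval env < M := by
  cases e with
  | var v => exact h.2
  | const c => exact h
  | bin o a b => exact h.2.2

theorem ArithOp.eval_compile {w : ℕ} {σ : Mem} {a b : Expr} (o : ArithOp)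
    (ha : a.eval w σ < 2 ^ w) (hb : b.eval w σ < 2 ^ w)
    (h : o.eval (a.eval w σ) (b.eval w σ) < 2 ^ w) :
    (o.compile a b).eval w σ = o.eval (a.eval w σ) (b.eval w σ) := by
  cases o <;> simp only [ArithOp.compile, Expr.eval, Op.eval, ArithOp.eval] at h ⊢
  case sub =>
    rcases Nat.lt_or_ge (b.eval w σ) (a.eval w σ) with hlt | hge
    · have h1 : a.eval w σ + (2 ^ w - b.eval w σ) = (a.eval w σ - b.eval w σ) + 2 ^ w := by omega
      have h2 : 1 % 2 ^ w = 1 := Nat.mod_eq_of_lt (by omega)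
      rw [if_pos hlt, h1, h2, Nat.add_mod_right, mul_one, Nat.mod_mod, Nat.mod_eq_of_lt h]
    · rw [if_neg (by omega)]
      simp
      omega
  all_goals exact Nat.mod_eq_of_lt h

theorem Arith.eval_compile {w : ℕ} {σ : Mem} {env : List ℕ} (e : Arith)
    (hσ : ∀ v < env.length, σ 5 v = env.getD v 0) (h : e.Safe (2 ^ w) env) :
    (e.compile env.length).eval w σ = e.eval env := by
  induction e with
  | var v =>
    simp only [Arith.compile, Arith.eval]
    split
    · next hv => simp only [Expr.eval]; rw [Nat.mod_eq_of_lt h.1, hσ v hv]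
    · next hv =>
      simp only [Expr.eval]
      rw [List.getD_eq_default _ _ (by omega), Nat.zero_mod]
  | const c => exact Nat.mod_eq_of_lt h
  | bin o a b iha ihb =>
    have ha := iha h.1
    have hb := ihb h.2.1
    simp only [Arith.compile, Arith.eval]
    rw [ArithOp.eval_compile o (ha ▸ h.1.lt) (hb ▸ h.2.1.lt) (by rw [ha, hb]; exact h.2.2), ha, hb]

/-- The items of an output: a letter which is `yes` if the cell `pos` of the input is nonzero
and `no` otherwise, the end of a string, and the end of a group. -/
inductive Token where
  | letter (pos yes no : ℕ)
  | endString
  | endGroup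

/-- Generators. -/
inductive Gen where
  | skip
  | emit (pos yes no : Arith)
  | endString
  | endGroup
  | seq (G H : Gen)
  | letIn (e : Arith) (G : Gen)
  | guard (e : Arith) (G : Gen)
  | loop (e : Arith) (G : Gen)

/-- The items that a generator puts out. -/
def Gen.tokens : Gen → List ℕ → List Token
  | .skip, _ => []
  | .emit p y n, env => [.letter (p.eval env) (y.eval env) (n.eval env)]
  | .endString, _ => [.endString]
  | .endGroup, _ => [.endGroup]
  | .seq G H, env => G.tokens env ++ H.tokens env
  | .letIn e G, env => G.tokens (env ++ [e.eval env])
  | .guard e G, env => if e.eval env = 0 then [] else G.tokens env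
  | .loop e G, env => (List.range (e.eval env)).flatMap fun i => G.tokens (env ++ [i])

/-- The work of a generator, which measures the time up to a constant factor. -/
def Gen.work : Gen → List ℕ → ℕ
  | .skip, _ => 1
  | .emit _ _ _, _ => 1
  | .endString, _ => 1
  | .endGroup, _ => 1
  | .seq G H, env => G.work env + H.work env
  | .letIn e G, env => 1 + G.work (env ++ [e.eval env])
  | .guard e G, env => 1 + if e.eval env = 0 then 0 else G.work env
  | .loop e G, env => 1 + ∑ i ∈ Finset.range (e.eval env), (1 + G.work (env ++ [i]))

/-- All values and addresses that occur are below `M`. -/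
def Gen.Safe (M : ℕ) : Gen → List ℕ → Prop
  | .skip, _ => True
  | .emit p y n, env => p.Safe M env ∧ y.Safe M env ∧ n.Safe M env
  | .endString, _ => True
  | .endGroup, _ => True
  | .seq G H, env => G.Safe M env ∧ H.Safe M env
  | .letIn e G, env => e.Safe M env ∧ env.length < M ∧ G.Safe M (env ++ [e.eval env])
  | .guard e G, env => e.Safe M env ∧ G.Safe M env
  | .loop e G, env => e.Safe M env ∧ env.length < M ∧ ∀ i < e.eval env, G.Safe M (env ++ [i])

/-- The expression that reads cell `c` of bank 9, a counter of the output. -/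
def counter (c : ℕ) : Expr := .load 9 (.const c)

/-- The program that increments cell `c` of bank 9. -/
def countUp (c : ℕ) : Prog := .store 9 (.const c) (.bin .add (counter c) (.const 1))

/-- The program of a generator; the output is written to the banks from 6 on. -/
def Gen.compile : ℕ → Gen → Prog
  | _, .skip => .skip
  | d, .emit p y n =>
    .seq (.ite (.load 0 (p.compile d)) (.store 6 (counter 2) (y.compile d))
      (.store 6 (counter 2) (n.compile d))) (countUp 2)
  | _, .endString => .seq (countUp 1) (.store 7 (counter 1) (counter 2))
  | _, .endGroup => .seq (countUp 0) (.store 8 (counter 0) (counter 1))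
  | d, .seq G H => .seq (G.compile d) (H.compile d)
  | d, .letIn e G => .seq (.store 5 (.const d) (e.compile d)) (G.compile (d + 1))
  | d, .guard e G => .ite (e.compile d) (G.compile d) .skip
  | d, .loop e G =>
    .seq (.store 5 (.const d) (.const 0)) <|
    .while (.bin .lt (.load 5 (.const d)) (e.compile d)) <|
      .seq (G.compile (d + 1))
        (.store 5 (.const d) (.bin .add (.load 5 (.const d)) (.const 1)))

/-- Partial outputs: the letters, the ends of the strings, and the ends of the groups. -/
structure Acc where
  /-- the letters -/
  ltr : List ℕ
  /-- the positions at which the strings end -/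
  str : List ℕ
  /-- the numbers of the strings at which the groups end -/
  grp : List ℕ

/-- Adding an item. -/
def Acc.push (L : ℕ → ℕ) (A : Acc) : Token → Acc
  | .letter p y n => { A with ltr := A.ltr ++ [if L p = 0 then n else y] }
  | .endString => { A with str := A.str ++ [A.ltr.length] }
  | .endGroup => { A with grp := A.grp ++ [A.str.length] }

/-- Adding a list of items. -/
def Acc.run (L : ℕ → ℕ) (A : Acc) (l : List Token) : Acc := l.foldl (Acc.push L) A

/-- The number of items of a partial output. -/
def Acc.size (A : Acc) : ℕ := A.ltr.length + A.str.length + A.grp.length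

/-- The memory that holds a partial output. -/
def Acc.mem (A : Acc) : Mem := fun b a =>
  match b with
  | 0 => A.ltr.getD a 0
  | 1 => (0 :: A.str).getD a 0
  | 2 => (0 :: A.grp).getD a 0
  | 3 => [A.grp.length, A.str.length, A.ltr.length].getD a 0
  | _ => 0

theorem Acc.size_push (L : ℕ → ℕ) (A : Acc) (t : Token) : (A.push L t).size = A.size + 1 := by
  cases t <;> simp [Acc.push, Acc.size] <;> omega

theorem Acc.run_append (L : ℕ → ℕ) (A : Acc) (l l' : List Token) :
    A.run L (l ++ l') = (A.run L l).run L l' := List.foldl_append ..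

theorem Acc.size_run (L : ℕ → ℕ) (A : Acc) (l : List Token) :
    (A.run L l).size = A.size + l.length := by
  induction l generalizing A with
  | nil => rfl
  | cons t l ih =>
    change ((A.push L t).run L l).size = _
    rw [ih, Acc.size_push, List.length_cons]; omega

/-- The memory during the run of a generator on the input `L`. -/
structure Inv (L : ℕ → ℕ) (env : List ℕ) (A : Acc) (σ : Mem) : Prop where
  input : ∀ a, σ 0 a = L a
  vars : ∀ v < env.length, σ 5 v = env.getD v 0
  out : ∀ b a, σ (6 + b) a = A.mem b a

/-- The invariant constrains only the cells below the length of the environment, so a variable that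
leaves its scope may stay in memory. -/
theorem Inv.pop {L : ℕ → ℕ} {env : List ℕ} {i : ℕ} {A : Acc} {σ : Mem}
    (h : Inv L (env ++ [i]) A σ) : Inv L env A σ where
  input := h.input
  vars v hv := by
    rw [h.vars v (by simp; omega), List.getD_append _ _ _ _ hv]
  out := h.out

theorem Inv.assign {L : ℕ → ℕ} {env : List ℕ} {A : Acc} {σ : Mem} (h : Inv L env A σ) (i : ℕ) :
    Inv L (env ++ [i]) A
      (Function.update σ 5 (Function.update (σ 5) env.length i)) where
  input a := by simpa [Function.update_of_ne] using h.input a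
  vars v hv := by
    rw [Function.update_self]
    rcases Nat.lt_or_ge v env.length with h1 | h1
    · rw [Function.update_of_ne (by omega), h.vars v h1, List.getD_append _ _ _ _ h1]
    · have : v = env.length := by simp at hv; omega
      subst this
      simp
  out b a := by
    rw [Function.update_of_ne (by omega)]
    exact h.out b a

theorem getD_append_singleton (l : List ℕ) (x a : ℕ) :
    (l ++ [x]).getD a 0 = if a = l.length then x else l.getD a 0 := by
  split
  · next h => subst h; simp
  · next h =>
    rcases Nat.lt_or_ge a l.length with h1 | h1
    · exact List.getD_append _ _ _ _ h1
    · rw [List.getD_eq_default _ _ h1, List.getD_eq_default _ _ (by simp; omega)]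

theorem counter_eval {σ : Mem} {w c : ℕ} (hc : c < 2 ^ w) : (counter c).eval w σ = σ 9 c := by
  simp only [counter, Expr.eval, Nat.mod_eq_of_lt hc]

theorem countUp_exec {σ : Mem} {w c : ℕ} (hc : c < 2 ^ w) (h : σ 9 c + 1 < 2 ^ w) :
    Exec w (countUp c) σ (Function.update σ 9 (Function.update (σ 9) c (σ 9 c + 1))) 6 := by
  have h1 := Exec.store (w := w) σ 9 (.const c) (.bin .add (counter c) (.const 1))
  have h2 : (Expr.bin .add (counter c) (.const 1)).eval w σ = σ 9 c + 1 := by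
    simp only [Expr.eval, counter_eval hc, Op.eval, Nat.mod_eq_of_lt (show 1 < 2 ^ w by omega)]
    exact Nat.mod_eq_of_lt h
  rw [h2] at h1
  simp only [Expr.eval, Nat.mod_eq_of_lt hc] at h1
  exact h1

/-- Bank 9 is bank 3 of the output encoding, so the counters that drive the writing are themselves
part of the output. -/
theorem Inv.pushLetter {L : ℕ → ℕ} {env : List ℕ} {A : Acc} {σ : Mem} (h : Inv L env A σ)
    (v : ℕ) : Inv L env { A with ltr := A.ltr ++ [v] }
      (Function.update (Function.update σ 6 (Function.update (σ 6) A.ltr.length v)) 9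
        (Function.update (σ 9) 2 (A.ltr.length + 1))) where
  input a := by simpa [Function.update_of_ne] using h.input a
  vars v hv := by simpa [Function.update_of_ne] using h.vars v hv
  out b a := by
    match b with
    | 0 =>
      have := h.out 0 a
      simp only [Acc.mem] at this ⊢
      rw [getD_append_singleton, ← this, Function.update_of_ne (by omega), Function.update_self,
        Function.update_apply]
    | 1 => simpa [Function.update_of_ne, Acc.mem] using h.out 1 a
    | 2 => simpa [Function.update_of_ne, Acc.mem] using h.out 2 a
    | 3 =>
      have := h.out 3 a
      match a with
      | 0 => simpa [Acc.mem, Function.update_apply] using this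
      | 1 => simpa [Acc.mem, Function.update_apply] using this
      | 2 => simp [Acc.mem]
      | a + 3 => simpa [Acc.mem, Function.update_apply] using this
    | b + 4 =>
      rw [Function.update_of_ne (by omega), Function.update_of_ne (by omega)]
      exact h.out (b + 4) a

theorem getD_cons_append_singleton (l : List ℕ) (x a : ℕ) :
    (0 :: (l ++ [x])).getD a 0 = if a = l.length + 1 then x else (0 :: l).getD a 0 := by
  rw [← List.cons_append, getD_append_singleton, List.length_cons]

/-- Cell 0 of bank 7 stays 0, the start of the first string, and the end of string number `a`
belongs in cell `a + 1`. Hence the counter is incremented before the store. -/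
theorem Inv.pushString {L : ℕ → ℕ} {env : List ℕ} {A : Acc} {σ : Mem} (h : Inv L env A σ)
    (v : ℕ) : Inv L env { A with str := A.str ++ [v] }
      (Function.update (Function.update σ 9 (Function.update (σ 9) 1 (A.str.length + 1))) 7
        (Function.update (σ 7) (A.str.length + 1) v)) where
  input a := by simpa [Function.update_of_ne] using h.input a
  vars v hv := by simpa [Function.update_of_ne] using h.vars v hv
  out b a := by
    match b with
    | 0 => simpa [Function.update_of_ne, Acc.mem] using h.out 0 a
    | 1 =>
      have := h.out 1 a
      simp only [Acc.mem] at this ⊢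
      rw [getD_cons_append_singleton, ← this, Function.update_self, Function.update_apply]
    | 2 => simpa [Function.update_of_ne, Acc.mem] using h.out 2 a
    | 3 =>
      have := h.out 3 a
      match a with
      | 0 => simpa [Acc.mem, Function.update_apply] using this
      | 1 => simp [Acc.mem]
      | 2 => simpa [Acc.mem, Function.update_apply] using this
      | a + 3 => simpa [Acc.mem, Function.update_apply] using this
    | b + 4 =>
      rw [Function.update_of_ne (by omega), Function.update_of_ne (by omega)]
      exact h.out (b + 4) a

theorem Inv.pushGroup {L : ℕ → ℕ} {env : List ℕ} {A : Acc} {σ : Mem} (h : Inv L env A σ)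
    (v : ℕ) : Inv L env { A with grp := A.grp ++ [v] }
      (Function.update (Function.update σ 9 (Function.update (σ 9) 0 (A.grp.length + 1))) 8
        (Function.update (σ 8) (A.grp.length + 1) v)) where
  input a := by simpa [Function.update_of_ne] using h.input a
  vars v hv := by simpa [Function.update_of_ne] using h.vars v hv
  out b a := by
    match b with
    | 0 => simpa [Function.update_of_ne, Acc.mem] using h.out 0 a
    | 1 => simpa [Function.update_of_ne, Acc.mem] using h.out 1 a
    | 2 =>
      have := h.out 2 a
      simp only [Acc.mem] at this ⊢
      rw [getD_cons_append_singleton, ← this, Function.update_self, Function.update_apply]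
    | 3 =>
      have := h.out 3 a
      match a with
      | 0 => simp [Acc.mem]
      | 1 => simpa [Acc.mem, Function.update_apply] using this
      | 2 => simpa [Acc.mem, Function.update_apply] using this
      | a + 3 => simpa [Acc.mem, Function.update_apply] using this
    | b + 4 =>
      rw [Function.update_of_ne (by omega), Function.update_of_ne (by omega)]
      exact h.out (b + 4) a

theorem letter_exec {L : ℕ → ℕ} {env : List ℕ} {A : Acc} {σ : Mem} {w : ℕ} (e : Arith)
    (h : Inv L env A σ) (hw : 3 ≤ 2 ^ w) (hs : A.size + 1 < 2 ^ w) (he : e.Safe (2 ^ w) env) :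
    ∃ σ₁ σ₂, Exec w (.store 6 (counter 2) (e.compile env.length)) σ σ₁
        ((e.compile env.length).cost + 3) ∧ Exec w (countUp 2) σ₁ σ₂ 6 ∧
      Inv L env { A with ltr := A.ltr ++ [e.eval env] } σ₂ := by
  have h1 := Exec.store (w := w) σ 6 (counter 2) (e.compile env.length)
  have h9 : σ 9 2 = A.ltr.length := h.out 3 2
  have hlt : A.ltr.length + 1 < 2 ^ w := by simp only [Acc.size] at hs; omega
  have ht : (counter 2).cost + (e.compile env.length).cost + 1 =
      (e.compile env.length).cost + 3 := by simp only [counter, Expr.cost]; omega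
  rw [counter_eval (by omega), Arith.eval_compile e h.vars he, h9, ht] at h1
  refine ⟨_, _, h1, countUp_exec (by omega) ?_, ?_⟩
  · rw [Function.update_of_ne (by omega), h9]; exact hlt
  · convert h.pushLetter (e.eval env) using 2
    rw [Function.update_of_ne (by omega), h9]

theorem emit_exec {L : ℕ → ℕ} {env : List ℕ} {A : Acc} {σ : Mem} {w : ℕ} (p y n : Arith)
    (h : Inv L env A σ) (hw : 3 ≤ 2 ^ w) (hs : A.size + 1 < 2 ^ w)
    (safe : (Gen.emit p y n).Safe (2 ^ w) env) :
    ∃ σ' t, Exec w ((Gen.emit p y n).compile env.length) σ σ' t ∧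
      Inv L env (A.run L ((Gen.emit p y n).tokens env)) σ' ∧
      t ≤ (p.compile env.length).cost + (y.compile env.length).cost
        + (n.compile env.length).cost + 20 := by
  obtain ⟨hp, hy, hn⟩ := safe
  have hc : (Expr.load 0 (p.compile env.length)).eval w σ = L (p.eval env) := by
    simp only [Expr.eval]
    rw [Arith.eval_compile p h.vars hp, h.input]
  by_cases h0 : L (p.eval env) = 0
  · obtain ⟨σ₁, σ₂, e1, e2, hi⟩ := letter_exec n h hw hs hn
    refine ⟨σ₂, _, .seq (.iteFalse (by rw [hc, h0]) e1) e2, ?_, ?_⟩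
    · simpa [Gen.tokens, Acc.run, Acc.push, h0] using hi
    · simp only [Expr.cost]; omega
  · obtain ⟨σ₁, σ₂, e1, e2, hi⟩ := letter_exec y h hw hs hy
    refine ⟨σ₂, _, .seq (.iteTrue (by rw [hc]; exact h0) e1) e2, ?_, ?_⟩
    · simpa [Gen.tokens, Acc.run, Acc.push, h0] using hi
    · simp only [Expr.cost]; omega

theorem endString_exec {L : ℕ → ℕ} {env : List ℕ} {A : Acc} {σ : Mem} {w : ℕ} (d : ℕ)
    (h : Inv L env A σ) (hw : 3 ≤ 2 ^ w) (hs : A.size + 1 < 2 ^ w) :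
    ∃ σ', Exec w (Gen.endString.compile d) σ σ' 11 ∧
      Inv L env (A.run L (Gen.endString.tokens env)) σ' := by
  have h9 : σ 9 1 = A.str.length := h.out 3 1
  have h9' : σ 9 2 = A.ltr.length := h.out 3 2
  have hlt : A.str.length + 1 < 2 ^ w := by simp only [Acc.size] at hs; omega
  refine ⟨_, .seq (countUp_exec (by omega) (by rw [h9]; exact hlt)) (.store _ _ _ _), ?_⟩
  rw [counter_eval (by omega), counter_eval (by omega), Function.update_self,
    Function.update_self, Function.update_of_ne (show 1 ≠ 2 by omega).symm, h9, h9',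
    Function.update_of_ne (show 7 ≠ 9 by omega)]
  exact h.pushString A.ltr.length

theorem endGroup_exec {L : ℕ → ℕ} {env : List ℕ} {A : Acc} {σ : Mem} {w : ℕ} (d : ℕ)
    (h : Inv L env A σ) (hw : 3 ≤ 2 ^ w) (hs : A.size + 1 < 2 ^ w) :
    ∃ σ', Exec w (Gen.endGroup.compile d) σ σ' 11 ∧
      Inv L env (A.run L (Gen.endGroup.tokens env)) σ' := by
  have h9 : σ 9 0 = A.grp.length := h.out 3 0
  have h9' : σ 9 1 = A.str.length := h.out 3 1
  have hlt : A.grp.length + 1 < 2 ^ w := by simp only [Acc.size] at hs; omega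
  refine ⟨_, .seq (countUp_exec (by omega) (by rw [h9]; exact hlt)) (.store _ _ _ _), ?_⟩
  rw [counter_eval (by omega), counter_eval (by omega), Function.update_self,
    Function.update_self, Function.update_of_ne (show 0 ≠ 1 by omega).symm, h9, h9',
    Function.update_of_ne (show 8 ≠ 9 by omega)]
  exact h.pushGroup A.str.length

theorem assign_exec {L : ℕ → ℕ} {env : List ℕ} {A : Acc} {σ : Mem} {w : ℕ} (e : Expr)
    (h : Inv L env A σ) (hd : env.length < 2 ^ w) :
    ∃ σ', Exec w (.store 5 (.const env.length) e) σ σ' (e.cost + 2) ∧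
      Inv L (env ++ [e.eval w σ]) A σ' := by
  have h1 := Exec.store (w := w) σ 5 (.const env.length) e
  refine ⟨_, ?_, h.assign _⟩
  convert h1 using 1
  · simp only [Expr.eval, Nat.mod_eq_of_lt hd]
  · simp only [Expr.cost]; omega

/-- The compiled program does what the generator says, in time proportional to its work. -/
theorem Gen.compile_exec (G : Gen) (d : ℕ) : ∃ C : ℕ, ∀ (w : ℕ) (L : ℕ → ℕ) (env : List ℕ)
    (A : Acc) (σ : Mem), env.length = d → 3 ≤ 2 ^ w → G.Safe (2 ^ w) env →
    A.size + (G.tokens env).length < 2 ^ w → Inv L env A σ →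
    ∃ σ' t, Exec w (G.compile d) σ σ' t ∧ Inv L env (A.run L (G.tokens env)) σ' ∧
      t ≤ C * G.work env := by
  induction G generalizing d with
  | skip => exact ⟨1, fun w L env A σ _ _ _ _ h => ⟨σ, 1, .skip σ, h, by simp [Gen.work]⟩⟩
  | emit p y n =>
    refine ⟨(p.compile d).cost + (y.compile d).cost + (n.compile d).cost + 20,
      fun w L env A σ hd hw hsafe hs h => ?_⟩
    subst hd
    simpa only [Gen.work, mul_one] using emit_exec p y n h hw hs hsafe
  | endString =>
    refine ⟨11, fun w L env A σ hd hw hsafe hs h => ?_⟩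
    obtain ⟨σ', h1, h2⟩ := endString_exec d h hw hs
    exact ⟨σ', _, h1, h2, by simp [Gen.work]⟩
  | endGroup =>
    refine ⟨11, fun w L env A σ hd hw hsafe hs h => ?_⟩
    obtain ⟨σ', h1, h2⟩ := endGroup_exec d h hw hs
    exact ⟨σ', _, h1, h2, by simp [Gen.work]⟩
  | seq G H ihG ihH =>
    obtain ⟨C₁, h₁⟩ := ihG d
    obtain ⟨C₂, h₂⟩ := ihH d
    refine ⟨C₁ + C₂, fun w L env A σ hd hw hsafe hs h => ?_⟩
    simp only [Gen.tokens, List.length_append] at hs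
    obtain ⟨σ₁, t₁, e₁, i₁, b₁⟩ := h₁ w L env A σ hd hw hsafe.1 (by omega) h
    obtain ⟨σ₂, t₂, e₂, i₂, b₂⟩ := h₂ w L env _ σ₁ hd hw hsafe.2 (by rw [Acc.size_run]; omega) i₁
    refine ⟨σ₂, _, .seq e₁ e₂, ?_, ?_⟩
    · simpa only [Gen.tokens, Acc.run_append] using i₂
    · simp only [Gen.work]; nlinarith
  | letIn e G ih =>
    obtain ⟨C, hC⟩ := ih (d + 1)
    refine ⟨(e.compile d).cost + 2 + C, fun w L env A σ hd hw hsafe hs h => ?_⟩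
    subst hd
    obtain ⟨σ₁, e₁, i₁⟩ := assign_exec (e.compile env.length) h hsafe.2.1
    rw [Arith.eval_compile e h.vars hsafe.1] at i₁
    obtain ⟨σ₂, t₂, e₂, i₂, b₂⟩ := hC w L _ A σ₁ (by simp) hw hsafe.2.2 hs i₁
    exact ⟨σ₂, _, .seq e₁ e₂, i₂.pop, by simp only [Gen.work]; nlinarith⟩
  | guard e G ih =>
    obtain ⟨C, hC⟩ := ih d
    refine ⟨(e.compile d).cost + 2 + C, fun w L env A σ hd hw hsafe hs h => ?_⟩
    subst hd
    have he := Arith.eval_compile e h.vars hsafe.1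
    by_cases h0 : e.eval env = 0
    · refine ⟨σ, _, .iteFalse (he.trans h0) (.skip σ), ?_, ?_⟩
      · simp only [Gen.tokens, if_pos h0]; exact h
      · simp only [Gen.work, if_pos h0]; nlinarith
    · simp only [Gen.tokens, if_neg h0] at hs
      obtain ⟨σ₂, t₂, e₂, i₂, b₂⟩ := hC w L env A σ rfl hw hsafe.2 hs h
      refine ⟨σ₂, _, .iteTrue (by rw [he]; exact h0) e₂, ?_, ?_⟩
      · simpa only [Gen.tokens, if_neg h0] using i₂
      · simp only [Gen.work, if_neg h0]; nlinarith
  | loop e G ih =>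
    obtain ⟨C, hC⟩ := ih (d + 1)
    refine ⟨(e.compile d).cost + 20 + C, fun w L env A σ hd hw hsafe hs h => ?_⟩
    subst hd
    obtain ⟨hsafe_e, hd, hsafe_G⟩ := hsafe
    have hE : e.eval env < 2 ^ w := hsafe_e.lt
    -- Induction on the number `k` of iterations left, the loop variable being `i`. The bound `e` is
    -- evaluated anew in every test, with the same value because the outer variables are preserved.
    have key : ∀ k i A σ, i + k = e.eval env →
        A.size + ((List.range k).flatMap fun j => G.tokens (env ++ [i + j])).length < 2 ^ w →
        Inv L (env ++ [i]) A σ → ∃ σ' t,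
        Exec w (.while (.bin .lt (.load 5 (.const env.length)) (e.compile env.length)) <|
          .seq (G.compile (env.length + 1)) (.store 5 (.const env.length)
            (.bin .add (.load 5 (.const env.length)) (.const 1)))) σ σ' t ∧
        Inv L env (A.run L ((List.range k).flatMap fun j => G.tokens (env ++ [i + j]))) σ' ∧
        t ≤ ((e.compile env.length).cost + 20 + C) *
          (∑ j ∈ Finset.range k, (1 + G.work (env ++ [i + j]))) +
          ((e.compile env.length).cost + 4) := by
      have hcond : ∀ i A σ, Inv L (env ++ [i]) A σ →
          (Expr.bin .lt (.load 5 (.const env.length)) (e.compile env.length)).eval w σ =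
            if i < e.eval env then 1 else 0 := by
        intro i A σ h
        have hv : σ 5 env.length = i := by rw [h.vars _ (by simp)]; simp
        simp only [Expr.eval, Op.eval, Nat.mod_eq_of_lt hd, hv,
          Arith.eval_compile e h.pop.vars hsafe_e]
        exact Nat.mod_eq_of_lt (by split <;> omega)
      intro k
      induction k with
      | zero =>
        intro i A σ hi hs h
        refine ⟨σ, _, .whileFalse ?_, h.pop, ?_⟩
        · rw [hcond i A σ h, if_neg (by omega)]
        · simp only [Expr.cost]; omega
      | succ k ihk =>
        intro i A σ hi hs h
        rw [List.range_succ_eq_map, List.flatMap_cons, List.flatMap_map] at hs ⊢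
        simp only [Nat.succ_eq_add_one, add_zero, List.length_append] at hs ⊢
        have hsh : ∀ j, env ++ [i + (j + 1)] = env ++ [i + 1 + j] := fun j => by
          rw [Nat.add_right_comm, Nat.add_assoc]
        simp only [hsh] at hs ⊢
        obtain ⟨σ₁, t₁, e₁, i₁, b₁⟩ := hC w L _ A σ (by simp) hw (hsafe_G i (by omega))
          (by omega) h
        obtain ⟨σ₂, e₂, i₂⟩ := assign_exec
          (.bin .add (.load 5 (.const env.length)) (.const 1)) i₁.pop hd
        have hv : σ₁ 5 env.length = i := by rw [i₁.vars _ (by simp)]; simp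
        have hval : (Expr.bin .add (.load 5 (.const env.length)) (.const 1)).eval w σ₁ = i + 1 := by
          simp only [Expr.eval, Op.eval, Nat.mod_eq_of_lt hd, hv,
            Nat.mod_eq_of_lt (show 1 < 2 ^ w by omega)]
          exact Nat.mod_eq_of_lt (by omega)
        rw [hval] at i₂
        obtain ⟨σ₃, t₃, e₃, i₃, b₃⟩ := ihk (i + 1) _ σ₂ (by omega)
          (by rw [Acc.size_run]; omega) i₂
        refine ⟨σ₃, _, .whileTrue ?_ (.seq e₁ e₂) e₃, ?_, ?_⟩
        · rw [hcond i A σ h, if_pos (by omega)]; exact one_ne_zero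
        · rwa [Acc.run_append]
        · rw [Finset.sum_range_succ']
          simp only [hsh, add_zero, Expr.cost]
          nlinarith
    obtain ⟨σ₁, e₁, i₁⟩ := assign_exec (.const 0) h hd
    have h0 : (Expr.const 0).eval w σ = 0 := by simp [Expr.eval]
    rw [h0] at i₁
    obtain ⟨σ₂, t₂, e₂, i₂, b₂⟩ := key (e.eval env) 0 A σ₁ (by omega)
      (by simpa only [zero_add, Gen.tokens] using hs) i₁
    simp only [zero_add] at i₂ b₂
    refine ⟨σ₂, _, .seq e₁ e₂, i₂, ?_⟩
    simp only [Gen.work, Expr.cost]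
    nlinarith

/-! ### Polynomial bounds on the values in a run -/

theorem Arith.Safe.mono {M M' : ℕ} (hM : M ≤ M') {env : List ℕ} {e : Arith} (h : e.Safe M env) :
    e.Safe M' env := by
  induction e with
  | var v => exact ⟨h.1.trans_le hM, h.2.trans_le hM⟩
  | const c => exact Nat.lt_of_lt_of_le h hM
  | bin o a b iha ihb => exact ⟨iha h.1, ihb h.2.1, h.2.2.trans_le hM⟩

theorem Gen.Safe.mono {M M' : ℕ} (hM : M ≤ M') {G : Gen} {env : List ℕ} (h : G.Safe M env) :
    G.Safe M' env := by
  induction G generalizing env with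
  | skip => trivial
  | emit p y n => exact ⟨h.1.mono hM, h.2.1.mono hM, h.2.2.mono hM⟩
  | endString => trivial
  | endGroup => trivial
  | seq G H ihG ihH => exact ⟨ihG h.1, ihH h.2⟩
  | letIn e G ih => exact ⟨h.1.mono hM, h.2.1.trans_le hM, ih h.2.2⟩
  | guard e G ih => exact ⟨h.1.mono hM, ih h.2⟩
  | loop e G ih => exact ⟨h.1.mono hM, h.2.1.trans_le hM, fun i hi => ih (h.2.2 i hi)⟩

/-- A bound uniform in the operation: operands below `B ^ κ` and `B ^ μ` give a value of at most `B
^ (κ + μ)`. -/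
theorem ArithOp.eval_le (o : ArithOp) (a b : ℕ) : o.eval a b ≤ (a + 1) * (b + 1) := by
  cases o <;> simp only [ArithOp.eval]
  case add => nlinarith
  case sub => have := Nat.sub_le a b; nlinarith
  case mul => nlinarith
  case div => have := Nat.div_le_self a b; nlinarith
  case mod => have := Nat.mod_le a b; nlinarith
  case lt => split <;> nlinarith

/-- The expression is fixed, so its exponent `κ` does not depend on `B`. With `B` the size of the
input, this is why words of `κ` times its logarithm many bits exclude overflow. -/
theorem Arith.exists_safe (e : Arith) (D : ℕ) : ∃ κ, ∀ B env, 2 ≤ B →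
    (∀ v, env.getD v 0 ≤ B ^ D) → e.Safe (B ^ κ) env := by
  induction e with
  | var v =>
    refine ⟨v + (D + 1), fun B env hB h => ⟨?_, (h v).trans_lt ?_⟩⟩
    · calc v < 2 ^ v := Nat.lt_two_pow_self
        _ ≤ B ^ v := Nat.pow_le_pow_left hB v
        _ ≤ _ := Nat.pow_le_pow_right (by omega) (by omega)
    · exact Nat.pow_lt_pow_right (by omega) (by omega)
  | const c =>
    exact ⟨c, fun B env hB h => Nat.lt_two_pow_self.trans_le (Nat.pow_le_pow_left hB c)⟩
  | bin o a b iha ihb =>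
    obtain ⟨κ, ha⟩ := iha
    obtain ⟨μ, hb⟩ := ihb
    refine ⟨κ + μ + 1, fun B env hB h => ⟨(ha B env hB h).mono ?_, (hb B env hB h).mono ?_, ?_⟩⟩
    · exact Nat.pow_le_pow_right (by omega) (by omega)
    · exact Nat.pow_le_pow_right (by omega) (by omega)
    · calc o.eval (a.eval env) (b.eval env) ≤ _ := ArithOp.eval_le ..
        _ ≤ B ^ κ * B ^ μ := Nat.mul_le_mul (ha B env hB h).lt (hb B env hB h).lt
        _ = B ^ (κ + μ) := (pow_add ..).symm
        _ < _ := Nat.pow_lt_pow_right (by omega) (by omega)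

/-- The letters of an item are below `M`. -/
def Token.Below (M : ℕ) : Token → Prop
  | .letter _ y n => y < M ∧ n < M
  | _ => True

theorem Token.Below.mono {M M' : ℕ} (hM : M ≤ M') {t : Token} (h : t.Below M) : t.Below M' := by
  cases t with
  | letter p y n => exact ⟨h.1.trans_le hM, h.2.trans_le hM⟩
  | endString => trivial
  | endGroup => trivial

theorem getD_append_singleton_le {env : List ℕ} {i M : ℕ} (h : ∀ v, env.getD v 0 ≤ M) (hi : i ≤ M)
    (v : ℕ) : (env ++ [i]).getD v 0 ≤ M := by
  rw [getD_append_singleton]; split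
  · exact hi
  · exact h v

/-- Everything that occurs in a run is polynomially bounded. -/
theorem Gen.exists_safe (G : Gen) (D d : ℕ) : ∃ κ, ∀ B env, 2 ≤ B → env.length = d →
    (∀ v, env.getD v 0 ≤ B ^ D) → G.Safe (B ^ κ) env ∧ (G.tokens env).length < B ^ κ ∧
      ∀ t ∈ G.tokens env, t.Below (B ^ κ) := by
  induction G generalizing D d with
  | skip => exact ⟨1, fun B env hB _ _ => ⟨trivial, by simp [Gen.tokens]; omega,
      by simp [Gen.tokens]⟩⟩
  | emit p y n =>
    obtain ⟨κ₁, h₁⟩ := p.exists_safe D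
    obtain ⟨κ₂, h₂⟩ := y.exists_safe D
    obtain ⟨κ₃, h₃⟩ := n.exists_safe D
    refine ⟨κ₁ + κ₂ + κ₃ + 1, fun B env hB _ h => ?_⟩
    have hle : ∀ κ ≤ κ₁ + κ₂ + κ₃ + 1, B ^ κ ≤ B ^ (κ₁ + κ₂ + κ₃ + 1) := fun κ hκ =>
      Nat.pow_le_pow_right (by omega) hκ
    have s₁ := (h₁ B env hB h).mono (hle κ₁ (by omega))
    have s₂ := (h₂ B env hB h).mono (hle κ₂ (by omega))
    have s₃ := (h₃ B env hB h).mono (hle κ₃ (by omega))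
    refine ⟨⟨s₁, s₂, s₃⟩, ?_, ?_⟩
    · have := hle 1 (by omega)
      simp [Gen.tokens]; omega
    · simp only [Gen.tokens, List.mem_singleton, forall_eq]
      exact ⟨s₂.lt, s₃.lt⟩
  | endString => exact ⟨1, fun B env hB _ _ => ⟨trivial, by simp [Gen.tokens]; omega,
      by simp [Gen.tokens, Token.Below]⟩⟩
  | endGroup => exact ⟨1, fun B env hB _ _ => ⟨trivial, by simp [Gen.tokens]; omega,
      by simp [Gen.tokens, Token.Below]⟩⟩
  | seq G H ihG ihH =>
    obtain ⟨κ, hG⟩ := ihG D d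
    obtain ⟨μ, hH⟩ := ihH D d
    refine ⟨κ + μ + 1, fun B env hB hd h => ?_⟩
    obtain ⟨g₁, g₂, g₃⟩ := hG B env hB hd h
    obtain ⟨h₁, h₂, h₃⟩ := hH B env hB hd h
    have le₁ : B ^ κ ≤ B ^ (κ + μ) := Nat.pow_le_pow_right (by omega) (by omega)
    have le₂ : B ^ μ ≤ B ^ (κ + μ) := Nat.pow_le_pow_right (by omega) (by omega)
    have le₃ : 2 * B ^ (κ + μ) ≤ B ^ (κ + μ + 1) := by rw [pow_succ]; nlinarith
    refine ⟨⟨g₁.mono (by omega), h₁.mono (by omega)⟩, ?_, ?_⟩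
    · simp only [Gen.tokens, List.length_append]; omega
    · simp only [Gen.tokens, List.mem_append]
      rintro t (ht | ht)
      · exact (g₃ t ht).mono (by omega)
      · exact (h₃ t ht).mono (by omega)
  | letIn e G ih =>
    obtain ⟨κ₁, he⟩ := e.exists_safe D
    -- The new variable is only bounded by `B ^ κ₁`, so the body needs a larger exponent for its
    -- environment; this is why the induction generalizes over `D`.
    obtain ⟨κ₂, hG⟩ := ih (D + κ₁) (d + 1)
    refine ⟨κ₁ + d + κ₂, fun B env hB hd h => ?_⟩
    have hle : ∀ κ ≤ κ₁ + d + κ₂, B ^ κ ≤ B ^ (κ₁ + d + κ₂) := fun κ hκ =>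
      Nat.pow_le_pow_right (by omega) hκ
    have s₁ := he B env hB h
    obtain ⟨g₁, g₂, g₃⟩ := hG B (env ++ [e.eval env]) hB (by simp [hd])
      (getD_append_singleton_le
        (fun v => (h v).trans (Nat.pow_le_pow_right (by omega) (by omega)))
        (s₁.lt.le.trans (Nat.pow_le_pow_right (by omega) (by omega))))
    have hd' : env.length < B ^ d :=
      hd ▸ Nat.lt_two_pow_self.trans_le (Nat.pow_le_pow_left hB _)
    exact ⟨⟨s₁.mono (hle _ (by omega)), hd'.trans_le (hle _ (by omega)),
      g₁.mono (hle _ (by omega))⟩, g₂.trans_le (hle _ (by omega)),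
      fun t ht => (g₃ t ht).mono (hle _ (by omega))⟩
  | guard e G ih =>
    obtain ⟨κ₁, he⟩ := e.exists_safe D
    obtain ⟨κ₂, hG⟩ := ih D d
    refine ⟨κ₁ + κ₂, fun B env hB hd h => ?_⟩
    have hle : ∀ κ ≤ κ₁ + κ₂, B ^ κ ≤ B ^ (κ₁ + κ₂) := fun κ hκ =>
      Nat.pow_le_pow_right (by omega) hκ
    obtain ⟨g₁, g₂, g₃⟩ := hG B env hB hd h
    refine ⟨⟨(he B env hB h).mono (hle _ (by omega)), g₁.mono (hle _ (by omega))⟩, ?_, ?_⟩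
    · simp only [Gen.tokens]
      split
      · exact Nat.pow_pos (by omega)
      · exact g₂.trans_le (hle _ (by omega))
    · simp only [Gen.tokens]
      split
      · simp
      · exact fun t ht => (g₃ t ht).mono (hle _ (by omega))
  | loop e G ih =>
    obtain ⟨κ₁, he⟩ := e.exists_safe D
    obtain ⟨κ₂, hG⟩ := ih (D + κ₁) (d + 1)
    refine ⟨κ₁ + d + κ₂, fun B env hB hd h => ?_⟩
    have hle : ∀ κ ≤ κ₁ + d + κ₂, B ^ κ ≤ B ^ (κ₁ + d + κ₂) := fun κ hκ =>
      Nat.pow_le_pow_right (by omega) hκ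
    have s₁ := he B env hB h
    have hbody : ∀ i < e.eval env, _ := fun i hi => hG B (env ++ [i]) hB (by simp [hd])
      (getD_append_singleton_le
        (fun v => (h v).trans (Nat.pow_le_pow_right (by omega) (by omega)))
        ((hi.trans s₁.lt).le.trans (Nat.pow_le_pow_right (by omega) (by omega))))
    have hd' : env.length < B ^ d :=
      hd ▸ Nat.lt_two_pow_self.trans_le (Nat.pow_le_pow_left hB _)
    refine ⟨⟨s₁.mono (hle _ (by omega)), hd'.trans_le (hle _ (by omega)),
      fun i hi => (hbody i hi).1.mono (hle _ (by omega))⟩, ?_, ?_⟩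
    · simp only [Gen.tokens, List.length_flatMap]
      calc _ ≤ ((List.range (e.eval env)).map fun i => (G.tokens (env ++ [i])).length).length
            • B ^ κ₂ := List.sum_le_card_nsmul _ _ (by
              simp only [List.mem_map, List.mem_range]
              rintro _ ⟨i, hi, rfl⟩
              exact (hbody i hi).2.1.le)
        _ = e.eval env * B ^ κ₂ := by simp
        _ < B ^ κ₁ * B ^ κ₂ := Nat.mul_lt_mul_of_pos_right s₁.lt (Nat.pow_pos (by omega))
        _ = B ^ (κ₁ + κ₂) := (pow_add ..).symm
        _ ≤ _ := hle _ (by omega)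
    · simp only [Gen.tokens, List.mem_flatMap, List.mem_range]
      rintro t ⟨i, hi, ht⟩
      exact ((hbody i hi).2.2 t ht).mono (hle _ (by omega))

/-- Every item is paid for by a unit of work. Hence a bound on the running time also bounds the size
of the text, in `textSize_le_work`. -/
theorem Gen.length_tokens_le_work (G : Gen) (env : List ℕ) :
    (G.tokens env).length ≤ G.work env := by
  induction G generalizing env with
  | skip => simp [Gen.tokens]
  | emit p y n => simp [Gen.tokens, Gen.work]
  | endString => simp [Gen.tokens, Gen.work]
  | endGroup => simp [Gen.tokens, Gen.work]
  | seq G H ihG ihH =>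
    simp only [Gen.tokens, Gen.work, List.length_append]
    exact Nat.add_le_add (ihG env) (ihH env)
  | letIn e G ih =>
    simp only [Gen.tokens, Gen.work]
    exact (ih _).trans (by omega)
  | guard e G ih =>
    simp only [Gen.tokens, Gen.work]
    split
    · simp
    · exact (ih env).trans (by omega)
  | loop e G ih =>
    simp only [Gen.tokens, Gen.work, List.length_flatMap]
    rw [← List.sum_toFinset _ List.nodup_range, List.toFinset_range]
    exact (Finset.sum_le_sum fun i _ => (ih _).trans (by omega)).trans (Nat.le_add_left _ 1)

/-! ### Outputs as inputs of another program -/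

/-- Templates of letters: the cell of the input on which the letter depends, and its two values. -/
abbrev Cell := ℕ × ℕ × ℕ

/-- The letter of a template on the input `L`. -/
def Cell.inst (L : ℕ → ℕ) (c : Cell) : ℕ := if L c.1 = 0 then c.2.2 else c.2.1

/-- The data of a template. -/
def instantiate (L : ℕ → ℕ) (x : List (List (List Cell))) : Data :=
  x.map fun g => g.map fun s => s.map (Cell.inst L)

/-- The items of a string. -/
def stringTokens (s : List Cell) : List Token :=
  (s.map fun c => .letter c.1 c.2.1 c.2.2) ++ [.endString]

/-- The items of a group. -/
def groupTokens (g : List (List Cell)) : List Token := g.flatMap stringTokens ++ [.endGroup]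

/-- The items of a template. -/
def dataTokens (x : List (List (List Cell))) : List Token := x.flatMap groupTokens

/-- The lengths of the nonempty prefixes of a list of lists, when concatenated. -/
def prefixLengths {α : Type*} (l : List (List α)) : List ℕ :=
  (List.range l.length).map fun a => (l.take (a + 1)).flatten.length

theorem prefixLengths_append_singleton {α : Type*} (l : List (List α)) (s : List α) :
    prefixLengths (l ++ [s]) = prefixLengths l ++ [(l ++ [s]).flatten.length] := by
  simp only [prefixLengths, List.length_append, List.length_singleton, List.range_succ,
    List.map_append, List.map_singleton]
  congr 1
  · refine List.map_congr_left fun a ha => ?_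
    rw [List.take_append_of_le_length]
    exact List.mem_range.1 ha
  · rw [List.take_of_length_le (by simp)]

/-- The partial output with complete groups `D`, complete strings `S` in the next group and
letters `l` in the next string. -/
def Acc.of (D : Data) (S : List (List ℕ)) (l : List ℕ) : Acc where
  ltr := letters D ++ S.flatten ++ l
  str := prefixLengths (D.flatten ++ S)
  grp := prefixLengths D

theorem Acc.run_letters (L : ℕ → ℕ) (D : Data) (S : List (List ℕ)) (l : List ℕ) (s : List Cell) :
    (Acc.of D S l).run L (s.map fun c => .letter c.1 c.2.1 c.2.2) =
      Acc.of D S (l ++ s.map (Cell.inst L)) := by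
  induction s generalizing l with
  | nil => simp [Acc.run]
  | cons c s ih =>
    have : (Acc.of D S l).push L (.letter c.1 c.2.1 c.2.2) = Acc.of D S (l ++ [c.inst L]) := by
      simp [Acc.push, Acc.of, Cell.inst]
    change (((Acc.of D S l).push L _).run L _) = _
    rw [this, ih]
    simp

theorem Acc.run_string (L : ℕ → ℕ) (D : Data) (S : List (List ℕ)) (s : List Cell) :
    (Acc.of D S []).run L (stringTokens s) = Acc.of D (S ++ [s.map (Cell.inst L)]) [] := by
  rw [stringTokens, Acc.run_append, Acc.run_letters]
  simp only [Acc.run, List.foldl_cons, List.foldl_nil, Acc.push, Acc.of, List.nil_append,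
    ← List.append_assoc, prefixLengths_append_singleton]
  simp [letters]

theorem Acc.run_strings (L : ℕ → ℕ) (D : Data) (S : List (List ℕ)) (g : List (List Cell)) :
    (Acc.of D S []).run L (g.flatMap stringTokens) =
      Acc.of D (S ++ g.map fun s => s.map (Cell.inst L)) [] := by
  induction g generalizing S with
  | nil => simp [Acc.run]
  | cons s g ih => rw [List.flatMap_cons, Acc.run_append, Acc.run_string, ih]; simp

theorem Acc.run_data (L : ℕ → ℕ) (D : Data) (x : List (List (List Cell))) :
    (Acc.of D [] []).run L (dataTokens x) = Acc.of (D ++ instantiate L x) [] [] := by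
  induction x generalizing D with
  | nil => simp [Acc.run, dataTokens, instantiate]
  | cons g x ih =>
    rw [dataTokens, List.flatMap_cons, ← dataTokens, groupTokens, Acc.run_append, Acc.run_append,
      Acc.run_strings]
    have : (Acc.of D ([] ++ g.map fun s => s.map (Cell.inst L)) []).run L [.endGroup] =
        Acc.of (D ++ [g.map fun s => s.map (Cell.inst L)]) [] [] := by
      simp only [Acc.run, List.foldl_cons, List.foldl_nil, Acc.push, Acc.of, List.nil_append,
        prefixLengths_append_singleton]
      simp [letters, prefixLengths]
    rw [this, ih]
    simp [instantiate]

theorem getD_prefixLengths {α : Type*} (l : List (List α)) (a : ℕ) :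
    (0 :: prefixLengths l).getD a 0 =
      if a ≤ l.length then (l.take a).flatten.length else 0 := by
  cases a with
  | zero => simp
  | succ a =>
    rw [List.getD_cons_succ]
    split
    · next h =>
      rw [List.getD_eq_getElem _ _ (by simpa [prefixLengths] using h)]
      simp [prefixLengths]
    · next h => exact List.getD_eq_default _ _ (by simp [prefixLengths]; omega)

/-- The banks beyond the encoding are empty as well: the next program finds the clean memory it
expects. -/
theorem Acc.mem_of (x : Data) : (Acc.of x [] []).mem = enc x := by
  funext b a
  match b with
  | 0 => simp [Acc.mem, enc, Acc.of]
  | 1 => simpa [Acc.mem, enc, Acc.of] using getD_prefixLengths x.flatten a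
  | 2 => simpa [Acc.mem, enc, Acc.of] using getD_prefixLengths x a
  | 3 => simp [Acc.mem, enc, Acc.of, prefixLengths]
  | b + 4 => rfl

/-! ### Programs from generators -/

/-- The number of strings in the first group of an input. -/
def order (x : Data) : ℕ := (x.take 1).flatten.length

/-- The map of inputs that is given by templates depending on the order. -/
def templateMap (X : ℕ → List (List (List Cell))) (x : Data) : Data :=
  instantiate (fun p => (letters x).getD p 0) (X (order x))

theorem shape_instantiate (L L' : ℕ → ℕ) (X : List (List (List Cell))) :
    shape (instantiate L X) = shape (instantiate L' X) := by
  simp [shape, instantiate, Function.comp_def]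

theorem order_eq_of_shape (x : Data) : order x = ((shape x).take 1).flatten.length := by
  cases x <;> simp [order, shape]

theorem letters_instantiate (L : ℕ → ℕ) (X : List (List (List Cell))) :
    letters (instantiate L X) = X.flatten.flatten.map (Cell.inst L) := by
  simp [letters, instantiate, List.map_flatten]

/-- The template depends on the order alone, which is a function of the shape, and each of its cells
names the one input position that it reads. -/
theorem isLocal_templateMap (X : ℕ → List (List (List Cell))) : IsLocal (templateMap X) := by
  constructor
  · intro x y h
    rw [templateMap, templateMap, order_eq_of_shape x, h, ← order_eq_of_shape]
    exact shape_instantiate ..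
  · intro s q
    -- Beyond the end the cell `(0, 0, 0)` is used, whose letter is 0 on every input, in accordance
    -- with the default of `getD`.
    have h0 : ∀ L : ℕ → ℕ, Cell.inst L (0, 0, 0) = 0 := fun L => by simp [Cell.inst]
    refine ⟨((X (s.take 1).flatten.length).flatten.flatten.getD q (0, 0, 0)).1,
      fun x y hx hy h => ?_⟩
    have key : ∀ (L : ℕ → ℕ) (l : List Cell),
        (l.map (Cell.inst L)).getD q 0 = Cell.inst L (l.getD q (0, 0, 0)) := fun L l => by
      have := List.getD_map (n := q) (l := l) (d := ((0, 0, 0) : Cell)) (Cell.inst L)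
      rwa [h0] at this
    simp only [templateMap, letters_instantiate, order_eq_of_shape, hx, hy, key, Cell.inst, h]

/-- The program of a generator that starts with the order of the input as its only variable. -/
def Gen.program (G : Gen) : Prog :=
  .seq (.store 5 (.const 0) (.load 2 (.const 1))) (G.compile 1)

theorem order_le_dataSize (x : Data) : order x ≤ dataSize x := by
  have : order x ≤ x.flatten.length := by
    conv_rhs => rw [← List.take_append_drop 1 x]
    rw [List.flatten_append, List.length_append]
    exact Nat.le_add_right ..
  simp only [dataSize]; omega

theorem two_le_dataSize (x : Data) : 2 ≤ dataSize x := Nat.le_add_left ..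

theorem foldr_max_le {l : List ℕ} {M : ℕ} (h : ∀ a ∈ l, a ≤ M) : l.foldr max 0 ≤ M := by
  induction l with
  | nil => simp
  | cons a l ih =>
    simp only [List.foldr_cons]
    exact max_le (h a (by simp)) (ih fun b hb => h b (by simp [hb]))

theorem inv_start {L : ℕ → ℕ} (x : Data) (hL : ∀ p, L p = (letters x).getD p 0) :
    Inv L [] (Acc.of [] [] []) (enc x) where
  input a := (hL a).symm
  vars v hv := by simp at hv
  out b a := by
    rw [Acc.mem_of]
    have : enc x (6 + b) = fun _ => 0 := by rw [add_comm]; rfl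
    rw [this]
    match b with
    | 0 => simp [enc, letters]
    | 1 => simp [enc]
    | 2 => simp [enc]
    | 3 =>
      match a with
      | 0 => rfl
      | 1 => rfl
      | 2 => rfl
      | a + 3 => rfl
    | b + 4 => rfl

theorem Fits.mono {κ κ' w : ℕ} (h : κ ≤ κ') {x : Data} (hx : Fits κ' w x) : Fits κ w x :=
  (Nat.pow_le_pow_right (by have := two_le_dataSize x; omega) h).trans hx

theorem bounded_order (x : Data) (v : ℕ) : [order x].getD v 0 ≤ dataSize x ^ 1 := by
  rw [pow_one]
  cases v with
  | zero => exact order_le_dataSize x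
  | succ v => simp

/-- The program of a generator computes the map given by the templates that the generator
puts out, in time proportional to its work. -/
theorem Gen.program_exec {G : Gen} {X : ℕ → List (List (List Cell))}
    (hG : ∀ n, G.tokens [n] = dataTokens (X n)) : ∃ C κ : ℕ, ∀ x w, Fits κ w x →
    ∃ σ t, Exec w G.program (enc x) σ t ∧ (∀ b a, σ (6 + b) a = enc (templateMap X x) b a) ∧
      t ≤ C * G.work [order x] + 5 := by
  obtain ⟨C, hC⟩ := G.compile_exec 1
  obtain ⟨κ, hκ⟩ := G.exists_safe 1 1
  -- The exponent `κ` prevents overflow; the additional 2 yields `3 ≤ 2 ^ w`, so that all three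
  -- counters can be addressed.
  refine ⟨C, κ + 2, fun x w hw => ?_⟩
  have h2 := two_le_dataSize x
  obtain ⟨hs, hl, -⟩ := hκ (dataSize x) [order x] h2 rfl (bounded_order x)
  have hle : dataSize x ^ κ ≤ 2 ^ w := hw.mono (by omega)
  have h3 : 3 ≤ 2 ^ w := by
    have : dataSize x ^ 2 ≤ 2 ^ w := hw.mono (by omega)
    nlinarith
  obtain ⟨σ₁, e₁, i₁⟩ := assign_exec (w := w) (.load 2 (.const 1))
    (inv_start (L := fun p => (letters x).getD p 0) x fun _ => rfl) (by simp)
  -- Cell 1 of bank 2 is the number of the string at which the second group starts, which counts the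
  -- strings of the first; on the empty input it is 0.
  have hv : (Expr.load 2 (.const 1)).eval w (enc x) = order x := by
    simp only [Expr.eval, Nat.mod_eq_of_lt (show 1 < 2 ^ w by omega), enc, order]
    cases x <;> simp
  rw [hv, List.nil_append] at i₁
  obtain ⟨σ₂, t, e₂, i₂, b₂⟩ := hC w _ [order x] _ σ₁ rfl h3 (hs.mono hle)
    (by simpa [Acc.size, Acc.of, letters, prefixLengths] using hl.trans_le hle) i₁
  refine ⟨σ₂, _, .seq e₁ e₂, fun b a => ?_, ?_⟩
  · rw [i₂.out, hG, Acc.run_data, Acc.mem_of]; rfl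
  · simp only [Expr.cost]; omega

/-- The size of the result of a generator is polynomial in the size of the input. -/
theorem Gen.exists_dataSize_le {G : Gen} {X : ℕ → List (List (List Cell))}
    (hG : ∀ n, G.tokens [n] = dataTokens (X n)) :
    ∃ κ : ℕ, ∀ x, dataSize (templateMap X x) ≤ dataSize x ^ κ := by
  obtain ⟨κ, hκ⟩ := G.exists_safe 1 1
  -- The item count, the largest letter and the summand 2 in `dataSize` add up to at most `4 *
  -- dataSize x ^ κ`, and `4 ≤ dataSize x ^ 2`.
  refine ⟨κ + 2, fun x => ?_⟩
  have h2 := two_le_dataSize x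
  obtain ⟨-, hl, hb⟩ := hκ (dataSize x) [order x] h2 rfl (bounded_order x)
  rw [hG] at hl hb
  have hsize := Acc.size_run (fun p => (letters x).getD p 0) (Acc.of [] [] [])
    (dataTokens (X (order x)))
  rw [Acc.run_data] at hsize
  have hsize' : (templateMap X x).length + (templateMap X x).flatten.length
      + (letters (templateMap X x)).length = (dataTokens (X (order x))).length := by
    simp only [Acc.size, Acc.of, List.nil_append, prefixLengths, letters, List.flatten_nil,
      List.append_nil, List.length_map, List.length_range, List.length_nil] at hsize
    simp only [templateMap, letters]
    omega
  have hmax : (letters (templateMap X x)).foldr max 0 ≤ dataSize x ^ κ := by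
    refine foldr_max_le fun a ha => ?_
    simp only [templateMap, letters_instantiate, List.mem_map, List.mem_flatten] at ha
    obtain ⟨c, ⟨s, ⟨g, hg, hs⟩, hc⟩, rfl⟩ := ha
    have := hb (.letter c.1 c.2.1 c.2.2) (by
      simp only [dataTokens, groupTokens, stringTokens, List.mem_flatMap, List.mem_append,
        List.mem_map]
      exact ⟨g, hg, .inl ⟨s, hs, .inl ⟨c, hc, rfl⟩⟩⟩)
    simp only [Cell.inst]
    split
    · exact this.2.le
    · exact this.1.le
  have h1 : 1 ≤ dataSize x ^ κ := Nat.pow_pos (by omega)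
  calc dataSize (templateMap X x) ≤ 4 * dataSize x ^ κ := by
        have : dataSize (templateMap X x) = (templateMap X x).length
          + (templateMap X x).flatten.length + (letters (templateMap X x)).length
          + (letters (templateMap X x)).foldr max 0 + 2 := rfl
        omega
    _ ≤ dataSize x ^ 2 * dataSize x ^ κ := Nat.mul_le_mul_right _ (by nlinarith)
    _ = _ := by rw [← pow_add, add_comm]

/-! ### Running a program on the result -/

theorem Expr.eval_shift {w k : ℕ} {σ ρ : Mem} (h : ∀ b a, ρ (k + b) a = σ b a) (e : Expr) :
    (e.shift k).eval w ρ = e.eval w σ := by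
  induction e with
  | const c => rfl
  | load b e ih => simp only [Expr.shift, Expr.eval, ih, h]
  | bin o a b iha ihb => simp only [Expr.shift, Expr.eval, iha, ihb]

theorem Expr.cost_shift (k : ℕ) (e : Expr) : (e.shift k).cost = e.cost := by
  induction e with
  | const c => rfl
  | load b e ih => simp only [Expr.shift, Expr.cost, ih]
  | bin o a b iha ihb => simp only [Expr.shift, Expr.cost, iha, ihb]

/-- The renamed program neither reads nor writes banks below `k`, so it runs in lockstep with the
original from any memory that agrees on the banks from `k` on. -/
theorem Exec.shift {w k : ℕ} {M : Prog} {σ σ' : Mem} {t : ℕ} (h : Exec w M σ σ' t) :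
    ∀ ρ : Mem, (∀ b a, ρ (k + b) a = σ b a) →
      ∃ ρ', Exec w (M.shift k) ρ ρ' t ∧ ∀ b a, ρ' (k + b) a = σ' b a := by
  induction h with
  | skip σ => exact fun ρ h => ⟨ρ, .skip ρ, h⟩
  | store σ b e₁ e₂ =>
    intro ρ h
    have h1 := Exec.store (w := w) ρ (k + b) (e₁.shift k) (e₂.shift k)
    rw [Expr.cost_shift, Expr.cost_shift, Expr.eval_shift h, Expr.eval_shift h] at h1
    refine ⟨_, h1, fun b' a => ?_⟩
    by_cases hb : b' = b
    · subst hb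
      simp only [Function.update_self, Function.update_apply, h]
    · rw [Function.update_of_ne (by omega), Function.update_of_ne hb, h]
  | seq _ _ ih₁ ih₂ =>
    intro ρ h
    obtain ⟨ρ₁, e₁, h₁⟩ := ih₁ ρ h
    obtain ⟨ρ₂, e₂, h₂⟩ := ih₂ ρ₁ h₁
    exact ⟨ρ₂, .seq e₁ e₂, h₂⟩
  | @iteTrue c _ _ _ _ _ hc _ ih =>
    intro ρ h
    obtain ⟨ρ₁, e₁, h₁⟩ := ih ρ h
    rw [← Expr.cost_shift k c]
    exact ⟨ρ₁, .iteTrue (by rwa [Expr.eval_shift h]) e₁, h₁⟩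
  | @iteFalse c _ _ _ _ _ hc _ ih =>
    intro ρ h
    obtain ⟨ρ₁, e₁, h₁⟩ := ih ρ h
    rw [← Expr.cost_shift k c]
    exact ⟨ρ₁, .iteFalse (by rwa [Expr.eval_shift h]) e₁, h₁⟩
  | @whileTrue c _ _ _ _ _ _ hc _ _ ih₁ ih₂ =>
    intro ρ h
    obtain ⟨ρ₁, e₁, h₁⟩ := ih₁ ρ h
    obtain ⟨ρ₂, e₂, h₂⟩ := ih₂ ρ₁ h₁
    rw [← Expr.cost_shift k c]
    exact ⟨ρ₂, .whileTrue (by rwa [Expr.eval_shift h]) e₁ e₂, h₂⟩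
  | @whileFalse c _ _ hc =>
    intro ρ h
    rw [← Expr.cost_shift k c]
    exact ⟨ρ, .whileFalse (by rwa [Expr.eval_shift h]), h⟩

/-- The loop of `disjunction`. -/
def disjunctionLoop (k : ℕ) : Prog :=
  .while (.load (k + 4) (.const 0)) <|
    .seq (.ite (.load (k + 4) (.load (k + 4) (.const 0))) (.store 4 (.const 1) (.const 1)) .skip)
      (.store (k + 4) (.const 0) (.bin .sub (.load (k + 4) (.const 0)) (.const 1)))

/-- The length cell serves as the loop counter: while it holds `n + 1`, the bit in cell `n + 1` is
inspected. So the bits are read from the last to the first and cell 0 is never read as a bit. -/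
theorem disjunctionLoop_exec {w k : ℕ} (hk : 1 ≤ k) (hw : 2 ≤ 2 ^ w) (n : ℕ) (hn : n < 2 ^ w)
    (σ : Mem) (h : σ (k + 4) 0 = n) :
    ∃ σ' t, Exec w (disjunctionLoop k) σ σ' t ∧ σ' 4 0 = σ 4 0 ∧
      (σ' 4 1 ≠ 0 ↔ σ 4 1 ≠ 0 ∨ ∃ j < n, σ (k + 4) (j + 1) ≠ 0) ∧ t ≤ 30 * n + 3 := by
  have h1w : 1 % 2 ^ w = 1 := Nat.mod_eq_of_lt (by omega)
  induction n generalizing σ with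
  | zero =>
    refine ⟨σ, _, .whileFalse ?_, rfl, by simp, by simp [Expr.cost]⟩
    simp [Expr.eval, h]
  | succ n ih =>
    obtain ⟨σ₁, t₁, e₁, h40, h41, hrest, ht₁⟩ : ∃ σ₁ t₁, Exec w
        (.ite (.load (k + 4) (.load (k + 4) (.const 0))) (.store 4 (.const 1) (.const 1)) .skip)
        σ σ₁ t₁ ∧ σ₁ 4 0 = σ 4 0 ∧ (σ₁ 4 1 ≠ 0 ↔ σ 4 1 ≠ 0 ∨ σ (k + 4) (n + 1) ≠ 0) ∧
        σ₁ (k + 4) = σ (k + 4) ∧ t₁ ≤ 7 := by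
      have hc : (Expr.load (k + 4) (.load (k + 4) (.const 0))).eval w σ = σ (k + 4) (n + 1) := by
        simp [Expr.eval, h]
      by_cases h0 : σ (k + 4) (n + 1) = 0
      · exact ⟨σ, _, .iteFalse (hc.trans h0) (.skip σ), rfl, by simp [h0], rfl,
          by simp [Expr.cost]⟩
      · refine ⟨_, _, .iteTrue (by rwa [hc]) (.store _ _ _ _), ?_, ?_, ?_, by simp [Expr.cost]⟩
        · simp [Expr.eval, h1w]
        · simp [Expr.eval, h1w, h0]
        · rw [Function.update_of_ne (by omega)]
    have e₂ := Exec.store (w := w) σ₁ (k + 4) (.const 0)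
      (.bin .sub (.load (k + 4) (.const 0)) (.const 1))
    have hv : (Expr.bin .sub (.load (k + 4) (.const 0)) (.const 1)).eval w σ₁ = n := by
      simp only [Expr.eval, Op.eval, Nat.zero_mod, hrest, h, h1w]
      rw [show n + 1 + (2 ^ w - 1) = n + 2 ^ w by omega, Nat.add_mod_right]
      exact Nat.mod_eq_of_lt (by omega)
    have h0 : (Expr.const 0).eval w σ₁ = 0 := by simp [Expr.eval]
    rw [hv, h0] at e₂
    obtain ⟨σ₃, t₃, e₃, g40, g41, ht₃⟩ := ih (by omega)
      (Function.update σ₁ (k + 4) (Function.update (σ₁ (k + 4)) 0 n)) (by simp)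
    rw [Function.update_of_ne (by omega)] at g40 g41
    refine ⟨σ₃, _, .whileTrue ?_ (.seq e₁ e₂) e₃, g40.trans h40, ?_, ?_⟩
    · simp [Expr.eval, h]
    · rw [g41, h41, or_assoc]
      refine or_congr_right ?_
      simp only [Function.update_self, hrest, Function.update_of_ne (Nat.succ_ne_zero _)]
      constructor
      · rintro (h | ⟨j, hj, h⟩)
        · exact ⟨n, by omega, h⟩
        · exact ⟨j, by omega, h⟩
      · rintro ⟨j, hj, hne⟩
        rcases Nat.lt_succ_iff_lt_or_eq.1 hj with hj | rfl
        · exact .inr ⟨j, hj, hne⟩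
        · exact .inl hne
    · simp only [Expr.cost]; omega

theorem disjunction_exec {w k n : ℕ} {p : ℕ → Prop} (hk : 5 ≤ k) (hw : 2 ≤ 2 ^ w)
    (hn : n < 2 ^ w) {σ ρ : Mem} (hσ : Outputs σ n p) (h : ∀ b a, ρ (k + b) a = σ b a) :
    ∃ ρ' t, Exec w (disjunction k) ρ ρ' t ∧ Outputs ρ' 1 (fun _ => ∃ j < n, p j) ∧
      t ≤ 30 * n + 9 := by
  have h1w : 1 % 2 ^ w = 1 := Nat.mod_eq_of_lt (by omega)
  have e₁ := Exec.store (w := w) ρ 4 (.const 0) (.const 1)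
  have e₂ := Exec.store (w := w) (Function.update ρ 4 (Function.update (ρ 4) 0 1)) 4
    (.const 1) (.const 0)
  simp only [Expr.eval, h1w, Nat.zero_mod] at e₁ e₂
  set ρ₂ := Function.update (Function.update ρ 4 (Function.update (ρ 4) 0 1)) 4
    (Function.update (Function.update ρ 4 (Function.update (ρ 4) 0 1) 4) 1 0) with hρ₂
  have hbank : ρ₂ (k + 4) = σ 4 := by
    rw [hρ₂, Function.update_of_ne (by omega), Function.update_of_ne (by omega)]
    exact funext fun a => h 4 a
  obtain ⟨ρ', t, e₃, h0, h1, ht⟩ := disjunctionLoop_exec (k := k) (by omega) hw n hn ρ₂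
    (by rw [hbank]; exact hσ.1)
  refine ⟨ρ', _, .seq e₁ (.seq e₂ e₃), ⟨?_, ?_⟩, ?_⟩
  · rw [h0, hρ₂]; simp
  · intro j hj
    have : j = 0 := by omega
    subst this
    have h41 : ρ₂ 4 1 = 0 := by simp [hρ₂]
    rw [h1, h41, hbank]
    simp only [ne_eq, not_true_eq_false, false_or]
    exact exists_congr fun j => and_congr_right fun hj => hσ.2 j hj
  · simp only [Expr.cost]; omega

/-- Running an algorithm for EDSM on the result of a generator. -/
theorem Gen.reduceTo_exec {G : Gen} {X : ℕ → List (List (List Cell))}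
    (hG : ∀ n, G.tokens [n] = dataTokens (X n)) {M : Prog} {τ : ℕ → ℕ → ℕ → ℝ}
    (hM : SolvesEDSM M τ) :
    ∃ (C κ : ℕ) (K : ℝ), ∀ x P T, templateMap X x = [P] :: T → IsInstance P T →
      ∀ w, Fits κ w x → ∃ σ t, Exec w (reduceTo 6 G.program M) (enc x) σ t ∧
        Outputs σ 1 (fun _ => ∃ j < T.length, OccEndsAt P T j) ∧
        (t : ℝ) ≤ C * G.work [order x] + K * τ P.length T.length (textSize T)
          + 30 * T.length + 14 := by
  obtain ⟨C, κ₁, h₁⟩ := G.program_exec hG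
  obtain ⟨κ₂, h₂⟩ := G.exists_dataSize_le hG
  obtain ⟨K, κ₃, h₃⟩ := hM
  -- The size of the instance is at most the `κ₂`-th power of that of the input, hence the product.
  -- Using `κ₃ + 1` instead of `κ₃` makes the length of the text fit into a word even if `κ₃ = 0`.
  refine ⟨C, κ₁ + κ₂ * (κ₃ + 1) + 1, K, fun x P T hx hP w hw => ?_⟩
  have hfit : Fits (κ₃ + 1) w (templateMap X x) :=
    (Nat.pow_le_pow_left (h₂ x) _).trans (by
      rw [← pow_mul]; exact hw.mono (Nat.le_succ_of_le (Nat.le_add_left _ _)))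
  obtain ⟨σ₁, t₁, e₁, m₁, b₁⟩ := h₁ x w (hw.mono (by omega))
  rw [hx] at hfit m₁
  obtain ⟨σ₂, t₂, e₂, o₂, b₂⟩ := h₃ P T hP w (hfit.mono (by omega))
  obtain ⟨ρ, e₂', hρ⟩ := e₂.shift σ₁ m₁
  have hfit1 : dataSize ([P] :: T) ≤ 2 ^ w := by
    have : Fits 1 w ([P] :: T) := hfit.mono (by omega)
    simpa only [Fits, pow_one] using this
  have hT : T.length + 2 ≤ dataSize ([P] :: T) := by
    simp only [dataSize, List.length_cons]; omega
  obtain ⟨ρ', t₃, e₃, o₃, b₃⟩ := disjunction_exec (k := 6) (by omega)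
    ((two_le_dataSize _).trans hfit1) (by omega) o₂ hρ
  refine ⟨ρ', _, .seq e₁ (.seq e₂' e₃), o₃, ?_⟩
  have b₁' : (t₁ : ℝ) ≤ C * G.work [order x] + 5 := by exact_mod_cast b₁
  have b₃' : (t₃ : ℝ) ≤ 30 * T.length + 9 := by exact_mod_cast b₃
  push_cast
  linarith

/-! ### The instance of EDSM

The parameters are `r`, the block length `b = r ^ (q - 1)` and the order `r ^ q` of the padded
matrices. The pattern is the concatenation of `r ^ (q + 2)` pieces. -/

/-- The `z`-th piece of the pattern, which stands for a row and two blocks of columns. -/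
def piece (r b z : ℕ) : List ℕ :=
  (4 * (z / r) + 1) :: (List.replicate b 0 ++ (4 * (z % (r * r)) + 2) ::
    (List.replicate b 0 ++ [4 * (z / (r * r) * r + z % r) + 3]))

/-- The pattern. -/
def pattern (r b Z : ℕ) : List ℕ := 4 :: ((List.range Z).flatMap (piece r b) ++ [8])

/-- The `c`-th block of `l` consecutive pieces. -/
def chunk (r b l c : ℕ) : List ℕ := (List.range l).flatMap fun u => piece r b (c * l + u)

/-- The segment by which blocks of `r ^ t` pieces out of `r ^ D` are skipped. -/
def skipSegment (r b D t : ℕ) : List (List ℕ) :=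
  [] :: (List.range (r ^ (D - t))).map (chunk r b (r ^ t))

/-- The segments by which an initial part of the pattern is skipped. -/
def skipBefore (r b D : ℕ) : ℕ → List (List (List ℕ))
  | 0 => []
  | t + 1 => List.replicate r (skipSegment r b D t) ++ skipBefore r b D t

/-- The segments by which a final part of the pattern is skipped. -/
def skipAfter (r b D : ℕ) : ℕ → List (List (List ℕ))
  | 0 => []
  | t + 1 => skipAfter r b D t ++ List.replicate r (skipSegment r b D t)

/-- A segment with a string for every entry of a matrix. -/
def grid {α : Type*} (m : ℕ) (g : ℕ → ℕ → α) : List α :=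
  (List.range m).flatMap fun i => (List.range m).map fun j => g i j

/-- Letters whose value is fixed. -/
def fixed (s : List ℕ) : List Cell := s.map fun v => (0, v, v)

/-- The cell of the input that holds entry `i`, `j` of the matrix number `base`; a cell beyond the
end if there is no such entry. -/
def cellOf (n base i j : ℕ) : ℕ :=
  base * (n * n) + (i * n + j) +
    3 * (n * n) * ((if n < i + 1 then 1 else 0) + if n < j + 1 then 1 else 0)

/-- A letter that carries `v` and the tag `tag` if the cell `p` is nonzero. -/
def marker (p v tag : ℕ) : Cell := (p, 4 * v + tag, 4 * v + 12)

/-- The template of the instance. -/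
def blockTemplate (q n r b m : ℕ) : List (List (List Cell)) :=
  [[fixed (pattern r b (r ^ (q + 2)))]] ++ ([[fixed [4]]] ++
    ((skipBefore r b (q + 2) (q + 2)).map (List.map fixed) ++
    ([grid m fun i j => marker (cellOf n 0 i j) (i * r + j / b) 1 ::
        fixed (List.replicate (j % b) 0)] ++
    ([grid m fun j k => fixed (List.replicate (b - j % b) 0) ++
        marker (cellOf n 1 j k) (j / b * r + k / b) 2 :: fixed (List.replicate (k % b) 0)] ++
    ([grid m fun k i => fixed (List.replicate (b - k % b) 0) ++
        [marker (cellOf n 2 k i) (i * r + k / b) 3]] ++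
    ((skipAfter r b (q + 2) (q + 2)).map (List.map fixed) ++ [[fixed [8]]]))))))

/-- The template of the instance, including the choice of `r`. -/
def template (q n : ℕ) : List (List (List Cell)) :=
  (List.range n).flatMap fun x =>
    if x ^ q < n ∧ n < (x + 1) ^ q + 1 then
      blockTemplate q n (x + 1) ((x + 1) ^ (q - 1)) ((x + 1) ^ q)
    else []

/-! ### The generator of the instance -/

instance : Add Arith := ⟨.bin .add⟩
instance : Sub Arith := ⟨.bin .sub⟩
instance : Mul Arith := ⟨.bin .mul⟩
instance : Div Arith := ⟨.bin .div⟩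
instance : Mod Arith := ⟨.bin .mod⟩
instance (n : ℕ) : OfNat Arith n := ⟨.const n⟩

section
variable (env : List ℕ) (a b : Arith)

@[simp] theorem Arith.eval_add : (a + b).eval env = a.eval env + b.eval env := rfl
@[simp] theorem Arith.eval_sub : (a - b).eval env = a.eval env - b.eval env := rfl
@[simp] theorem Arith.eval_mul : (a * b).eval env = a.eval env * b.eval env := rfl
@[simp] theorem Arith.eval_div : (a / b).eval env = a.eval env / b.eval env := rfl
@[simp] theorem Arith.eval_mod : (a % b).eval env = a.eval env % b.eval env := rfl
@[simp] theorem Arith.eval_lt :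
    (Arith.bin .lt a b).eval env = if a.eval env < b.eval env then 1 else 0 := rfl
@[simp] theorem Arith.eval_ofNat (n : ℕ) : (no_index (OfNat.ofNat n) : Arith).eval env = OfNat.ofNat n := rfl
@[simp] theorem Arith.eval_const (n : ℕ) : (Arith.const n).eval env = n := rfl
@[simp] theorem Arith.eval_var (v : ℕ) : (Arith.var v).eval env = env.getD v 0 := rfl

end

/-- Powers with a fixed exponent. -/
def Arith.power (e : Arith) : ℕ → Arith
  | 0 => 1
  | k + 1 => e.power k * e

@[simp] theorem Arith.eval_power (env : List ℕ) (e : Arith) (k : ℕ) :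
    (e.power k).eval env = e.eval env ^ k := by
  induction k with
  | zero => simp [Arith.power]
  | succ k ih => simp [Arith.power, ih, pow_succ]

/-- A fixed letter. -/
def emitFixed (e : Arith) : Gen := .emit 0 e e

/-- A run of zeros. -/
def zeros (e : Arith) : Gen := .loop e (emitFixed 0)

/-- A piece of the pattern. -/
def pieceGen (z : Arith) : Gen :=
  .seq (emitFixed (4 * (z / .var 2) + 1)) <| .seq (zeros (.var 3)) <|
  .seq (emitFixed (4 * (z % (.var 2 * .var 2)) + 2)) <| .seq (zeros (.var 3)) <|
  emitFixed (4 * (z / (.var 2 * .var 2) * .var 2 + z % .var 2) + 3)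

/-- The end of a string and of its group. -/
def endBoth : Gen := .seq .endString .endGroup

/-- The pattern. -/
def patternGen (D : ℕ) : Gen :=
  .seq (emitFixed 4) <| .seq (.loop (Arith.power (.var 2) D) (pieceGen (.var 5))) <|
  .seq (emitFixed 8) endBoth

/-- The copies of a segment for skipping. -/
def skipGen (D t : ℕ) : Gen :=
  .loop (.var 2) <| .seq .endString <| .seq
    (.loop (Arith.power (.var 2) (D - t)) <|
      .seq (.loop (Arith.power (.var 2) t)
        (pieceGen (.var 6 * Arith.power (.var 2) t + .var 7))) .endString)
    .endGroup

/-- The segments before the matrices. -/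
def skipBeforeGen (D : ℕ) : ℕ → Gen
  | 0 => .skip
  | t + 1 => .seq (skipGen D t) (skipBeforeGen D t)

/-- The segments after the matrices. -/
def skipAfterGen (D : ℕ) : ℕ → Gen
  | 0 => .skip
  | t + 1 => .seq (skipAfterGen D t) (skipGen D t)

/-- A segment with a string for every entry of a matrix. -/
def gridGen (G : Gen) : Gen :=
  .seq (.loop (.var 4) (.loop (.var 4) (.seq G .endString))) .endGroup

/-- The cell of an entry of a matrix, at row `var 5` and column `var 6`. -/
def cellArith (base : ℕ) : Arith :=
  .const base * (.var 0 * .var 0) + (.var 5 * .var 0 + .var 6) +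
    3 * (.var 0 * .var 0) * (.bin .lt (.var 0) (.var 5 + 1) + .bin .lt (.var 0) (.var 6 + 1))

/-- A letter that depends on an entry of a matrix. -/
def markerGen (base : ℕ) (v : Arith) (tag : ℕ) : Gen :=
  .emit (cellArith base) (4 * v + .const tag) (4 * v + 12)

/-- The strings of the three matrices. -/
def matrixGen : Gen :=
  .seq (gridGen (.seq (markerGen 0 (.var 5 * .var 2 + .var 6 / .var 3) 1)
    (zeros (.var 6 % .var 3)))) <|
  .seq (gridGen (.seq (zeros (.var 3 - .var 5 % .var 3))
    (.seq (markerGen 1 (.var 5 / .var 3 * .var 2 + .var 6 / .var 3) 2)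
      (zeros (.var 6 % .var 3))))) <|
  gridGen (.seq (zeros (.var 3 - .var 5 % .var 3))
    (markerGen 2 (.var 6 * .var 2 + .var 5 / .var 3) 3))

/-- The instance for given parameters. -/
def blockGen (D : ℕ) : Gen :=
  .seq (patternGen D) <| .seq (.seq (emitFixed 4) endBoth) <| .seq (skipBeforeGen D D) <|
  .seq matrixGen <| .seq (skipAfterGen D D) (.seq (emitFixed 8) endBoth)

/-- The generator of the instance. -/
def instanceGen (q : ℕ) : Gen :=
  .loop (.var 0) <|
  .guard (.bin .lt (Arith.power (.var 1) q) (.var 0)) <|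
  .guard (.bin .lt (.var 0) (Arith.power (.var 1 + 1) q + 1)) <|
  .letIn (.var 1 + 1) <| .letIn (Arith.power (.var 2) (q - 1)) <|
  .letIn (Arith.power (.var 2) q) <| blockGen (q + 2)

/-- The items of the letters of a string. -/
def letterTokens (s : List Cell) : List Token := s.map fun c => .letter c.1 c.2.1 c.2.2

/-! ### The items put out by the generator of the instance -/

theorem letterTokens_append (s s' : List Cell) :
    letterTokens (s ++ s') = letterTokens s ++ letterTokens s' := List.map_append

theorem stringTokens_eq (s : List Cell) : stringTokens s = letterTokens s ++ [.endString] := rfl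

theorem fixed_append (s s' : List ℕ) : fixed (s ++ s') = fixed s ++ fixed s' := List.map_append

theorem letterTokens_fixed_flatMap (l : List ℕ) (f : ℕ → List ℕ) :
    letterTokens (fixed (l.flatMap f)) = l.flatMap fun i => letterTokens (fixed (f i)) := by
  simp only [letterTokens, fixed, List.map_flatMap]

theorem tokens_emitFixed (e : Arith) (env : List ℕ) :
    (emitFixed e).tokens env = letterTokens (fixed [e.eval env]) := rfl

theorem flatMap_range_const {α : Type*} (n : ℕ) (l : List α) :
    ((List.range n).flatMap fun _ => l) = (List.replicate n l).flatten := by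
  rw [List.flatMap_def, List.map_const', List.length_range]

theorem tokens_zeros (e : Arith) (env : List ℕ) :
    (zeros e).tokens env = letterTokens (fixed (List.replicate (e.eval env) 0)) := by
  simp only [zeros, Gen.tokens, tokens_emitFixed, Arith.eval_ofNat, flatMap_range_const]
  simp [letterTokens, fixed]

theorem tokens_pieceGen {z : Arith} {env : List ℕ} {r b : ℕ} (hr : env.getD 2 0 = r)
    (hb : env.getD 3 0 = b) :
    (pieceGen z).tokens env = letterTokens (fixed (piece r b (z.eval env))) := by
  subst hr hb
  simp only [pieceGen, Gen.tokens, tokens_emitFixed, tokens_zeros, ← letterTokens_append,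
    ← fixed_append, piece]
  simp

theorem tokens_endBoth (env : List ℕ) : endBoth.tokens env = [.endString, .endGroup] := rfl

theorem tokens_patternGen (D n x r b m : ℕ) :
    (patternGen D).tokens [n, x, r, b, m] = groupTokens [fixed (pattern r b (r ^ D))] := by
  have h : ∀ z, (pieceGen (.var 5)).tokens [n, x, r, b, m, z] =
      letterTokens (fixed (piece r b z)) := fun z => tokens_pieceGen rfl rfl
  simp only [patternGen, Gen.tokens, tokens_emitFixed, tokens_endBoth, Arith.eval_power,
    Arith.eval_ofNat, Arith.eval_var, List.cons_append, List.nil_append, h, groupTokens,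
    List.flatMap_cons, List.flatMap_nil, stringTokens_eq, pattern, List.append_assoc,
    List.getD_cons_succ, List.getD_cons_zero, ← letterTokens_fixed_flatMap]
  simp [letterTokens, fixed]

theorem tokens_skipGen (D t n x r b m : ℕ) :
    (skipGen D t).tokens [n, x, r, b, m] =
      dataTokens ((List.replicate r (skipSegment r b D t)).map (List.map fixed)) := by
  have h : ∀ i c u, (pieceGen (.var 6 * Arith.power (.var 2) t + .var 7)).tokens
      [n, x, r, b, m, i, c, u] = letterTokens (fixed (piece r b (c * r ^ t + u))) := fun i c u => by
    rw [tokens_pieceGen (r := r) (b := b) rfl rfl]; simp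
  simp only [skipGen, Gen.tokens, Arith.eval_power, Arith.eval_var, List.cons_append,
    List.nil_append, h, List.getD_cons_succ, List.getD_cons_zero, flatMap_range_const,
    dataTokens, List.map_replicate, List.flatMap_replicate]
  congr 2
  simp only [groupTokens, skipSegment, List.map_cons, List.flatMap_cons, List.map_map,
    List.flatMap_map, Function.comp_def, stringTokens_eq, chunk, letterTokens_fixed_flatMap]
  simp [letterTokens, fixed]

theorem dataTokens_append (X Y : List (List (List Cell))) :
    dataTokens (X ++ Y) = dataTokens X ++ dataTokens Y := List.flatMap_append

theorem tokens_skipBeforeGen (D t n x r b m : ℕ) :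
    (skipBeforeGen D t).tokens [n, x, r, b, m] =
      dataTokens ((skipBefore r b D t).map (List.map fixed)) := by
  induction t with
  | zero => rfl
  | succ t ih =>
    rw [skipBeforeGen, Gen.tokens, ih, tokens_skipGen, skipBefore, List.map_append,
      dataTokens_append]

theorem tokens_skipAfterGen (D t n x r b m : ℕ) :
    (skipAfterGen D t).tokens [n, x, r, b, m] =
      dataTokens ((skipAfter r b D t).map (List.map fixed)) := by
  induction t with
  | zero => rfl
  | succ t ih =>
    rw [skipAfterGen, Gen.tokens, ih, tokens_skipGen, skipAfter, List.map_append,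
      dataTokens_append]

theorem tokens_gridGen {G : Gen} {n x r b m : ℕ} {g : ℕ → ℕ → List Cell}
    (h : ∀ i j, G.tokens [n, x, r, b, m, i, j] = letterTokens (g i j)) :
    (gridGen G).tokens [n, x, r, b, m] = dataTokens [grid m g] := by
  simp only [gridGen, Gen.tokens, Arith.eval_var, List.cons_append, List.nil_append, h,
    List.getD_cons_succ, List.getD_cons_zero, dataTokens, List.flatMap_cons, List.flatMap_nil,
    List.append_nil, groupTokens, grid, List.flatMap_assoc, List.flatMap_map, stringTokens_eq]

theorem eval_cellArith (base n x r b m i j : ℕ) :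
    (cellArith base).eval [n, x, r, b, m, i, j] = cellOf n base i j := by
  simp [cellArith, cellOf]

theorem tokens_markerGen (base : ℕ) (v : Arith) (tag n x r b m i j : ℕ) :
    (markerGen base v tag).tokens [n, x, r, b, m, i, j] =
      letterTokens [marker (cellOf n base i j) (v.eval [n, x, r, b, m, i, j]) tag] := by
  rw [markerGen, Gen.tokens, eval_cellArith]
  rfl

theorem tokens_matrixGen (n x r b m : ℕ) : matrixGen.tokens [n, x, r, b, m] =
    dataTokens [grid m fun i j => marker (cellOf n 0 i j) (i * r + j / b) 1 ::
        fixed (List.replicate (j % b) 0)] ++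
    (dataTokens [grid m fun j k => fixed (List.replicate (b - j % b) 0) ++
        marker (cellOf n 1 j k) (j / b * r + k / b) 2 :: fixed (List.replicate (k % b) 0)] ++
    dataTokens [grid m fun k i => fixed (List.replicate (b - k % b) 0) ++
        [marker (cellOf n 2 k i) (i * r + k / b) 3]]) := by
  rw [matrixGen, Gen.tokens, Gen.tokens]
  congr 1
  · refine tokens_gridGen fun i j => ?_
    simp only [Gen.tokens, tokens_markerGen, tokens_zeros]
    simp [letterTokens]
  congr 1
  · refine tokens_gridGen fun i j => ?_
    simp only [Gen.tokens, tokens_markerGen, tokens_zeros]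
    simp [letterTokens]
  · refine tokens_gridGen fun i j => ?_
    simp only [Gen.tokens, tokens_markerGen, tokens_zeros]
    simp [letterTokens]

theorem tokens_blockGen (q n x r b m : ℕ) :
    (blockGen (q + 2)).tokens [n, x, r, b, m] = dataTokens (blockTemplate q n r b m) := by
  have h₄ : (Gen.seq (emitFixed 4) endBoth).tokens [n, x, r, b, m] = dataTokens [[fixed [4]]] :=
    rfl
  have h₈ : (Gen.seq (emitFixed 8) endBoth).tokens [n, x, r, b, m] = dataTokens [[fixed [8]]] :=
    rfl
  have hp : (patternGen (q + 2)).tokens [n, x, r, b, m] =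
      dataTokens [[fixed (pattern r b (r ^ (q + 2)))]] := by
    rw [tokens_patternGen]; simp [dataTokens]
  simp only [blockTemplate, dataTokens_append, ← h₄, ← h₈, ← hp, ← tokens_skipBeforeGen _ _ n x r b m,
    ← tokens_skipAfterGen _ _ n x r b m]
  simp only [blockGen, Gen.tokens, List.append_assoc, tokens_matrixGen]

theorem tokens_instanceGen (q n : ℕ) :
    (instanceGen q).tokens [n] = dataTokens (template q n) := by
  simp only [instanceGen, template, Gen.tokens]
  rw [dataTokens, List.flatMap_assoc]
  refine congrArg (fun f => List.flatMap f _) (funext fun x => ?_)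
  by_cases h₁ : x ^ q < n
  · by_cases h₂ : n < (x + 1) ^ q + 1
    · simp only [List.cons_append, List.nil_append, Arith.eval_lt, Arith.eval_power,
        Arith.eval_var, Arith.eval_add, Arith.eval_ofNat, List.getD_cons_succ,
        List.getD_cons_zero, h₁, h₂, if_true, and_self, one_ne_zero, if_false]
      exact tokens_blockGen ..
    · simp [h₁, h₂]
  · simp [h₁]

/-! ### Spelling a string by a sequence of segments -/

/-- The string is a concatenation of strings of the segments, one from each. -/
def Spells {α : Type*} : List (List (List α)) → List α → Prop
  | [], p => p = []
  | R :: Y, p => ∃ a ∈ R, ∃ c, p = a ++ c ∧ Spells Y c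

/-- Links the recursive form, which unfolds along a concrete text, to the `List.Forall₂` in
`Matches`. -/
theorem spells_iff {α : Type*} {Y : List (List (List α))} {p : List α} :
    Spells Y p ↔ ∃ qs, List.Forall₂ (fun q R => q ∈ R) qs Y ∧ p = qs.flatten := by
  induction Y generalizing p with
  | nil => simp [Spells]
  | cons R Y ih =>
    simp only [Spells, List.forall₂_cons_right_iff, ih]
    constructor
    · rintro ⟨a, ha, c, rfl, qs, hqs, rfl⟩
      exact ⟨_, ⟨a, qs, ha, hqs, rfl⟩, rfl⟩
    · rintro ⟨_, ⟨a, qs, ha, hqs, rfl⟩, rfl⟩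
      exact ⟨a, ha, _, rfl, qs, hqs, rfl⟩

theorem spells_append {α : Type*} {Y Y' : List (List (List α))} {p : List α} :
    Spells (Y ++ Y') p ↔ ∃ a c, p = a ++ c ∧ Spells Y a ∧ Spells Y' c := by
  induction Y generalizing p with
  | nil => simp [Spells]
  | cons R Y ih =>
    simp only [List.cons_append, Spells, ih]
    constructor
    · rintro ⟨a, ha, _, rfl, c, d, rfl, hc, hd⟩
      exact ⟨a ++ c, d, by simp, ⟨a, ha, c, rfl, hc⟩, hd⟩
    · rintro ⟨_, d, rfl, ⟨a, ha, c, rfl, hc⟩, hd⟩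
      exact ⟨a, ha, c ++ d, by simp, c, d, rfl, hc, hd⟩

/-- With unique letters at its two ends, the pattern matches only the whole text. -/
theorem exists_occEndsAt_iff {α : Type*} {Y : List (List (List α))} {p : List α} {x y : α}
    (hxy : x ≠ y) (hx : ∀ R ∈ Y, ∀ u ∈ R, x ∉ u) (hy : ∀ R ∈ Y, ∀ u ∈ R, y ∉ u) :
    (∃ j < ([[x]] :: (Y ++ [[[y]]])).length,
      OccEndsAt (x :: (p ++ [y])) ([[x]] :: (Y ++ [[[y]]])) j) ↔ Spells Y p := by
  set T := [[x]] :: (Y ++ [[[y]]]) with hT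
  have hlen : T.length = Y.length + 2 := by simp [hT]
  -- Only the first segment contains `x` and only the last contains `y`, so an occurrence starts in
  -- the former and ends in the latter.
  have hdrop : ∀ i, i ≠ 0 → ∀ R ∈ T.drop i, ∀ u ∈ R, x ∉ u := by
    intro i hi R hR u hu
    obtain ⟨i, rfl⟩ := Nat.exists_eq_succ_of_ne_zero hi
    rw [hT, List.drop_succ_cons] at hR
    rcases List.mem_append.1 (List.mem_of_mem_drop hR) with h | h
    · exact hx R h u hu
    · simp only [List.mem_singleton] at h
      subst h
      simp only [List.mem_singleton] at hu
      subst hu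
      simpa using hxy
  have htake : ∀ j, j + 1 < T.length → ∀ R ∈ T.take (j + 1), ∀ u ∈ R, y ∉ u := by
    intro j hj R hR u hu
    rw [hT, List.take_succ_cons, List.take_append_of_le_length (by omega)] at hR
    rcases List.mem_cons.1 hR with h | h
    · subst h
      simp only [List.mem_singleton] at hu
      subst hu
      simpa using hxy.symm
    · exact hy R (List.mem_of_mem_take h) u hu
  -- This excludes an occurrence inside a single string.
  have hboth : ∀ R ∈ T, ∀ u ∈ R, x ∈ u → y ∈ u → False := by
    intro R hR u hu h1 h2
    rcases List.mem_cons.1 hR with h | h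
    · subst h
      simp only [List.mem_singleton] at hu
      subst hu
      simp only [List.mem_singleton] at h2
      exact hxy h2.symm
    · exact hdrop 1 one_ne_zero R (by simpa [hT] using h) u hu h1
  rw [spells_iff]
  constructor
  · rintro ⟨j, hj, -, i, hij, ⟨S, hS, u, hu, hpu⟩ | ⟨S, Y', S', hX, a, qs, c, hp, ha, hc,
      ⟨u, hu, hau⟩, hqs, ⟨v, hv, hcv⟩⟩⟩
    · have hST : S ∈ T := List.mem_of_mem_take (List.mem_of_mem_drop (hS ▸ List.mem_singleton_self S))
      exact (hboth S hST u hu (hpu.subset (by simp)) (hpu.subset (by simp))).elim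
    · have hSX : S ∈ (T.take (j + 1)).drop i := by rw [hX]; simp
      have hSX' : S' ∈ (T.take (j + 1)).drop i := by rw [hX]; simp
      have hxa : x ∈ a := by
        cases a with
        | nil => exact absurd rfl ha
        | cons z a => simp only [List.cons_append, List.cons.injEq] at hp; simp [hp.1]
      have hyc : y ∈ c := by
        have h1 : (x :: (p ++ [y])).getLast? = some y := by
            rw [← List.cons_append, List.getLast?_concat]
        rw [hp, List.getLast?_append_of_ne_nil _ hc] at h1
        exact List.mem_of_getLast? h1
      have hi : i = 0 := by
        by_contra hi
        refine hdrop i hi S ?_ u hu (hau.subset hxa)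
        rw [List.drop_take] at hSX
        exact List.mem_of_mem_take hSX
      have hj' : j + 1 = T.length := by
        by_contra hj'
        exact htake j (by omega) S' (List.mem_of_mem_drop hSX') v hv (hcv.subset hyc)
      rw [hi, hj', List.take_length, List.drop_zero, hT] at hX
      simp only [List.cons.injEq] at hX
      obtain ⟨rfl, hX⟩ := hX
      obtain ⟨rfl, hX'⟩ := List.append_inj' hX rfl
      obtain rfl := List.singleton_injective hX'
      simp only [List.mem_singleton] at hu hv
      subst hu hv
      have ha' : a = [x] := by
        rcases List.suffix_cons_iff.1 hau with h | h
        · exact h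
        · exact absurd (List.suffix_nil.1 h) ha
      have hc' : c = [y] := by
        rcases List.prefix_cons_iff.1 hcv with h | ⟨t, rfl, h⟩
        · exact absurd h hc
        · rw [List.prefix_nil.1 h]
      subst ha' hc'
      simp only [List.cons_append, List.nil_append, List.cons.injEq, true_and] at hp
      exact ⟨qs, hqs, List.append_cancel_right hp⟩
  · rintro ⟨qs, hqs, rfl⟩
    refine ⟨T.length - 1, by omega, by omega, 0, by omega, .inr ⟨[[x]], Y, [[y]], ?_, [x], qs, [y],
      by simp, by simp, by simp, ⟨[x], by simp, List.suffix_rfl⟩, hqs, ⟨[y], by simp, List.prefix_rfl⟩⟩⟩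
    rw [List.drop_zero, List.take_of_length_le (by omega)]

/-! ### Pieces -/

/-- The `n` pieces from the `a`-th one on. -/
def pieces (r b a n : ℕ) : List ℕ := (List.range' a n).flatMap (piece r b)

theorem pieces_add (r b a n n' : ℕ) :
    pieces r b a (n + n') = pieces r b a n ++ pieces r b (a + n) n' := by
  rw [pieces, pieces, pieces, ← List.flatMap_append, List.range'_append_1]

theorem pieces_zero (r b a : ℕ) : pieces r b a 0 = [] := rfl

theorem pieces_one (r b a : ℕ) : pieces r b a 1 = piece r b a := by simp [pieces]

theorem chunk_eq_pieces (r b l c : ℕ) : chunk r b l c = pieces r b (c * l) l := by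
  rw [chunk, pieces, List.range'_eq_map_range, List.flatMap_map]

theorem length_piece (r b z : ℕ) : (piece r b z).length = 2 * b + 3 := by
  simp [piece]; omega

theorem length_pieces (r b a n : ℕ) : (pieces r b a n).length = n * (2 * b + 3) := by
  simp [pieces, List.length_flatMap, length_piece]

/-- Both sides are cut at their first nonzero letter. -/
theorem replicate_append_cons_inj {b c x y : ℕ} {s t : List ℕ} (hx : x ≠ 0) (hy : y ≠ 0)
    (h : List.replicate b 0 ++ x :: s = List.replicate c 0 ++ y :: t) : b = c ∧ x = y ∧ s = t := by
  induction b generalizing c with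
  | zero =>
    cases c with
    | zero => simpa using h
    | succ c => simp [List.replicate_succ, hx] at h
  | succ b ih =>
    cases c with
    | zero => simp [List.replicate_succ, hy.symm] at h
    | succ c =>
      simp only [List.replicate_succ, List.cons_append, List.cons.injEq, true_and] at h
      simpa using ih h

/-- The first letter determines `z / r`, and the second nonzero letter determines `z % (r * r)`,
hence `z % r`. -/
theorem piece_injective {r b : ℕ} {z z' : ℕ} (h : piece r b z = piece r b z') : z = z' := by
  simp only [piece, List.cons.injEq] at h
  obtain ⟨h1, h⟩ := h
  obtain ⟨-, h2, -⟩ := replicate_append_cons_inj (by omega) (by omega) h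
  have h3 : z % (r * r) % r = z' % (r * r) % r := by congr 1; omega
  rw [Nat.mod_mul_left_mod, Nat.mod_mul_left_mod] at h3
  rw [← Nat.div_add_mod z r, ← Nat.div_add_mod z' r, h3, show z / r = z' / r by omega]

theorem chunk_injective {r b l : ℕ} (hl : 0 < l) {c c' : ℕ} (h : chunk r b l c = chunk r b l c') :
    c = c' := by
  obtain ⟨l, rfl⟩ := Nat.exists_eq_succ_of_ne_zero hl.ne'
  rw [chunk_eq_pieces, chunk_eq_pieces, Nat.succ_eq_add_one, Nat.add_comm l 1, pieces_add,
    pieces_add, pieces_one, pieces_one] at h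
  have := piece_injective (List.append_inj h (by simp [length_piece])).1
  exact Nat.eq_of_mul_eq_mul_right (by omega) this

theorem chunk_ne_nil {r b l : ℕ} (hl : 0 < l) (c : ℕ) : chunk r b l c ≠ [] := by
  rw [chunk_eq_pieces, ← List.length_pos_iff, length_pieces]
  positivity

theorem nodup_skipSegment {r b D t : ℕ} (hr : 0 < r) : (skipSegment r b D t).Nodup := by
  have hl : 0 < r ^ t := Nat.pow_pos hr
  rw [skipSegment, List.nodup_cons]
  refine ⟨?_, List.nodup_range.map fun c c' h => chunk_injective hl h⟩
  simp only [List.mem_map, not_exists, not_and]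
  exact fun c _ => chunk_ne_nil hl c

theorem mem_skipBefore {r b D t : ℕ} {R : List (List ℕ)} (h : R ∈ skipBefore r b D t) :
    ∃ s, R = skipSegment r b D s := by
  induction t with
  | zero => simp [skipBefore] at h
  | succ t ih =>
    rcases List.mem_append.1 h with h | h
    · exact ⟨t, List.eq_of_mem_replicate h⟩
    · exact ih h

theorem mem_skipAfter {r b D t : ℕ} {R : List (List ℕ)} (h : R ∈ skipAfter r b D t) :
    ∃ s, R = skipSegment r b D s := by
  induction t with
  | zero => simp [skipAfter] at h
  | succ t ih =>
    rcases List.mem_append.1 h with h | h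
    · exact ih h
    · exact ⟨t, List.eq_of_mem_replicate h⟩

theorem skipSegment_zero_mem {r b D t : ℕ} (hr : 0 < r) (ht : 0 < t) :
    skipSegment r b D 0 ∈ skipBefore r b D t := by
  induction t with
  | zero => omega
  | succ t ih =>
    rcases Nat.eq_zero_or_pos t with rfl | h
    · simp [skipBefore]; omega
    · exact List.mem_append_right _ (ih h)

theorem exists_of_mem_skipSegment {r b D t : ℕ} {u : List ℕ} (h : u ∈ skipSegment r b D t) :
    ∃ zs : List ℕ, u = zs.flatMap (piece r b) := by
  simp only [skipSegment, List.mem_cons, List.mem_map] at h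
  rcases h with rfl | ⟨c, -, rfl⟩
  · exact ⟨[], rfl⟩
  · exact ⟨_, chunk_eq_pieces ..⟩

theorem Spells.exists_flatMap_piece {r b : ℕ} {Y : List (List (List ℕ))}
    (hY : ∀ R ∈ Y, ∀ u ∈ R, ∃ zs : List ℕ, u = zs.flatMap (piece r b)) {p : List ℕ}
    (h : Spells Y p) : ∃ zs : List ℕ, p = zs.flatMap (piece r b) := by
  induction Y generalizing p with
  | nil => exact ⟨[], h⟩
  | cons R Y ih =>
    obtain ⟨a, ha, c, rfl, hc⟩ := h
    obtain ⟨zs, rfl⟩ := hY R (by simp) a ha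
    obtain ⟨zs', rfl⟩ := ih (fun R hR => hY R (by simp [hR])) hc
    exact ⟨zs ++ zs', List.flatMap_append.symm⟩

/-- All pieces have the same length, so cutting off whole pieces leaves a cut at a piece boundary.
-/
theorem exists_of_flatMap_piece_append {r b : ℕ} {zs ws : List ℕ} {s : List ℕ}
    (h : zs.flatMap (piece r b) ++ s = ws.flatMap (piece r b)) :
    ∃ ws' : List ℕ, s = ws'.flatMap (piece r b) := by
  induction zs generalizing ws with
  | nil => exact ⟨ws, h⟩
  | cons z zs ih =>
    cases ws with
    | nil => simp [piece] at h
    | cons w ws =>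
      simp only [List.flatMap_cons, List.append_assoc] at h
      exact ih (List.append_inj h (by simp [length_piece])).2

/-! ### Skipping pieces digit by digit -/

theorem spells_replicate_skipSegment {r b D t : ℕ} (ht : t ≤ D) (hr : 0 < r) (k d e : ℕ)
    (hd : d ≤ k) (h : (e + d) * r ^ t ≤ r ^ D) :
    Spells (List.replicate k (skipSegment r b D t)) (pieces r b (e * r ^ t) (d * r ^ t)) := by
  induction k generalizing d e with
  | zero =>
    obtain rfl : d = 0 := by omega
    simp [Spells, pieces_zero]
  | succ k ih =>
    -- The first `d` copies contribute consecutive chunks, the remaining ones the empty string.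
    rw [List.replicate_succ]
    rcases Nat.eq_zero_or_pos d with rfl | hpos
    · exact ⟨[], by simp [skipSegment], _, rfl, ih 0 e (by omega) h⟩
    · obtain ⟨d, rfl⟩ := Nat.exists_eq_succ_of_ne_zero hpos.ne'
      refine ⟨chunk r b (r ^ t) e, ?_, pieces r b ((e + 1) * r ^ t) (d * r ^ t), ?_,
        ih d (e + 1) (by omega) (by convert h using 2; omega)⟩
      · simp only [skipSegment, List.mem_cons, List.mem_map, List.mem_range]
        refine .inr ⟨e, ?_, rfl⟩
        rw [← Nat.sub_add_cancel ht, pow_add] at h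
        have := Nat.le_of_mul_le_mul_right h (Nat.pow_pos hr)
        omega
      · rw [chunk_eq_pieces, show (d + 1) * r ^ t = r ^ t + d * r ^ t by ring, pieces_add,
          Nat.succ_mul]

/-- The base `r` digits of `n` are consumed from the most significant one on; each is below `r`, so
`r` copies per level suffice. The start is a general multiple of `r ^ t` because the rest after the
top digit starts at a multiple of the next lower power, and the bound on `e` keeps all chunks among
the `r ^ D` pieces. -/
theorem spells_skipBefore {r b D t : ℕ} (ht : t ≤ D) (hr : 0 < r) (e n : ℕ) (hn : n < r ^ t)
    (h : (e + 1) * r ^ t ≤ r ^ D) : Spells (skipBefore r b D t) (pieces r b (e * r ^ t) n) := by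
  induction t generalizing e n with
  | zero =>
    obtain rfl : n = 0 := by simpa using hn
    exact pieces_zero ..
  | succ t ih =>
    have hpos : 0 < r ^ t := Nat.pow_pos hr
    have hd : n / r ^ t < r := Nat.div_lt_of_lt_mul (by rwa [pow_succ] at hn)
    have key : e * r + n / r ^ t + 1 ≤ (e + 1) * r := by rw [Nat.succ_mul]; omega
    have hle : (e * r + n / r ^ t + 1) * r ^ t ≤ r ^ D :=
      (Nat.mul_le_mul_right _ key).trans (by rw [mul_assoc, ← pow_succ']; exact h)
    rw [skipBefore, spells_append]
    refine ⟨pieces r b (e * r * r ^ t) (n / r ^ t * r ^ t),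
      pieces r b ((e * r + n / r ^ t) * r ^ t) (n % r ^ t), ?_,
      spells_replicate_skipSegment (by omega) hr _ _ _ hd.le
        ((Nat.mul_le_mul_right _ (by omega)).trans hle),
      ih (by omega) _ _ (Nat.mod_lt _ hpos) hle⟩
    rw [add_mul, ← pieces_add, Nat.div_add_mod', mul_assoc, ← pow_succ']

/-- The mirror image: now the end is aligned instead of the start, and the least significant digits
come first. -/
theorem spells_skipAfter {r b D t : ℕ} (ht : t ≤ D) (hr : 0 < r) (e s n : ℕ) (hn : n < r ^ t)
    (hs : s + n = (e + 1) * r ^ t) (h : (e + 1) * r ^ t ≤ r ^ D) :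
    Spells (skipAfter r b D t) (pieces r b s n) := by
  induction t generalizing e s n with
  | zero =>
    obtain rfl : n = 0 := by simpa using hn
    exact pieces_zero ..
  | succ t ih =>
    have hpos : 0 < r ^ t := Nat.pow_pos hr
    have hd : n / r ^ t < r := Nat.div_lt_of_lt_mul (by rwa [pow_succ] at hn)
    -- The chunks of the top digit start at chunk `e' + 1`, where the lower digits have to end.
    obtain ⟨e', he'⟩ : ∃ e', e' + 1 + n / r ^ t = (e + 1) * r :=
      ⟨(e + 1) * r - n / r ^ t - 1, by
        have : r ≤ (e + 1) * r := Nat.le_mul_of_pos_left _ (by omega)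
        omega⟩
    have hmul : (e' + 1) * r ^ t + n / r ^ t * r ^ t = (e + 1) * r ^ (t + 1) := by
      rw [← add_mul, he', mul_assoc, ← pow_succ']
    have hn' := Nat.div_add_mod' n (r ^ t)
    rw [skipAfter, spells_append]
    refine ⟨pieces r b s (n % r ^ t), pieces r b ((e' + 1) * r ^ t) (n / r ^ t * r ^ t), ?_,
      ih (by omega) e' _ _ (Nat.mod_lt _ hpos) (by omega) (by omega),
      spells_replicate_skipSegment (by omega) hr _ _ _ hd.le (by rw [add_mul]; omega)⟩
    rw [show (e' + 1) * r ^ t = s + n % r ^ t by omega, ← pieces_add, add_comm, hn']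

/-! ### The segments of the matrices -/

/-- A letter that carries `v` and the tag `tag` if `a` is nonzero. -/
def mark (a v tag : ℕ) : ℕ := if a = 0 then 4 * v + 12 else 4 * v + tag

/-- The string of entry `i`, `j` of the first matrix. -/
def leftString (r b : ℕ) (A : ℕ → ℕ → ℕ) (i j : ℕ) : List ℕ :=
  mark (A i j) (i * r + j / b) 1 :: List.replicate (j % b) 0

/-- The string of entry `j`, `k` of the second matrix. -/
def midString (r b : ℕ) (B : ℕ → ℕ → ℕ) (j k : ℕ) : List ℕ :=
  List.replicate (b - j % b) 0 ++ mark (B j k) (j / b * r + k / b) 2 :: List.replicate (k % b) 0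

/-- The string of entry `k`, `i` of the third matrix. -/
def rightString (r b : ℕ) (C : ℕ → ℕ → ℕ) (k i : ℕ) : List ℕ :=
  List.replicate (b - k % b) 0 ++ [mark (C k i) (i * r + k / b) 3]

theorem mark_ne_zero {a v tag : ℕ} (h : tag ≠ 0) : mark a v tag ≠ 0 := by
  unfold mark; split <;> omega

/-- The letter of a zero entry is divisible by 4, unlike any letter with a tag from 1 to 3. -/
theorem mark_eq {a v tag v' : ℕ} (h : 0 < tag) (h' : tag < 4)
    (he : mark a v tag = 4 * v' + tag) : a ≠ 0 ∧ v = v' := by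
  unfold mark at he; split at he <;> omega

/-- The letter of a zero entry still carries `v`, and its residue modulo 4 separates it from those
of the nonzero entries. This keeps the strings of a segment distinct for all matrices, as
`IsInstance` demands. -/
theorem mark_inj {a v tag a' v' : ℕ} (h : 0 < tag) (h' : tag < 4)
    (he : mark a v tag = mark a' v' tag) : v = v' := by
  unfold mark at he; split at he <;> split at he <;> omega

theorem mem_grid {α : Type*} {m : ℕ} {g : ℕ → ℕ → α} {s : α} :
    s ∈ grid m g ↔ ∃ i < m, ∃ j < m, g i j = s := by
  simp [grid]

theorem nodup_grid {α : Type*} {m : ℕ} {g : ℕ → ℕ → α}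
    (h : ∀ i < m, ∀ j < m, ∀ i' < m, ∀ j' < m, g i j = g i' j' → i = i' ∧ j = j') :
    (grid m g).Nodup := by
  rw [grid, List.nodup_flatMap]
  refine ⟨fun i hi => List.nodup_range.map_on fun j hj j' hj' he =>
    (h i (List.mem_range.1 hi) j (List.mem_range.1 hj) i (List.mem_range.1 hi) j'
      (List.mem_range.1 hj') he).2, ?_⟩
  refine List.nodup_range.imp_of_mem fun {i i'} hi hi' hne => ?_
  simp only [Function.onFun, List.disjoint_left, List.mem_map, List.mem_range, not_exists, not_and]
  rintro _ ⟨j, hj, rfl⟩ j' hj' he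
  exact hne (h i (List.mem_range.1 hi) j hj i' (List.mem_range.1 hi') j' hj' he.symm).1

theorem eq_of_mul_add_eq {r a c a' c' : ℕ} (hc : c < r) (hc' : c' < r)
    (h : a * r + c = a' * r + c') : a = a' ∧ c = c' := by
  have hr : 0 < r := by omega
  constructor
  · have := congrArg (· / r) h
    simpa [Nat.add_div_of_dvd_right (Nat.dvd_mul_left r _), Nat.mul_div_cancel _ hr,
      Nat.div_eq_of_lt hc, Nat.div_eq_of_lt hc'] using this
  · have := congrArg (· % r) h
    simpa [Nat.mul_add_mod', Nat.mod_eq_of_lt hc, Nat.mod_eq_of_lt hc'] using this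

theorem eq_of_div_mod {b j j' : ℕ} (h : j / b = j' / b) (h' : j % b = j' % b) : j = j' := by
  rw [← Nat.div_add_mod j b, ← Nat.div_add_mod j' b, h, h']

section
variable {r b : ℕ} (hb : 0 < b)
include hb

theorem div_lt_of_lt {j : ℕ} (h : j < r * b) : j / b < r := (Nat.div_lt_iff_lt_mul hb).2 h

theorem leftString_inj {A : ℕ → ℕ → ℕ} {i j i' j' : ℕ} (hj : j < r * b) (hj' : j' < r * b)
    (h : leftString r b A i j = leftString r b A i' j') : i = i' ∧ j = j' := by
  simp only [leftString, List.cons.injEq] at h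
  obtain ⟨h1, h2⟩ := eq_of_mul_add_eq (div_lt_of_lt hb hj) (div_lt_of_lt hb hj')
    (mark_inj (by omega) (by omega) h.1)
  exact ⟨h1, eq_of_div_mod h2 (by simpa using congrArg List.length h.2)⟩

theorem midString_inj {B : ℕ → ℕ → ℕ} {j k j' k' : ℕ} (hk : k < r * b) (hk' : k' < r * b)
    (h : midString r b B j k = midString r b B j' k') : j = j' ∧ k = k' := by
  obtain ⟨h0, h1, h2⟩ := replicate_append_cons_inj (mark_ne_zero (by omega))
    (mark_ne_zero (by omega)) h
  obtain ⟨h3, h4⟩ := eq_of_mul_add_eq (div_lt_of_lt hb hk) (div_lt_of_lt hb hk')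
    (mark_inj (by omega) (by omega) h1)
  have := Nat.mod_lt j hb
  have := Nat.mod_lt j' hb
  exact ⟨eq_of_div_mod h3 (by omega), eq_of_div_mod h4 (by simpa using congrArg List.length h2)⟩

theorem rightString_inj {C : ℕ → ℕ → ℕ} {k i k' i' : ℕ} (hk : k < r * b) (hk' : k' < r * b)
    (h : rightString r b C k i = rightString r b C k' i') : k = k' ∧ i = i' := by
  obtain ⟨h0, h1, -⟩ := replicate_append_cons_inj (mark_ne_zero (by omega))
    (mark_ne_zero (by omega)) h
  obtain ⟨h3, h4⟩ := eq_of_mul_add_eq (div_lt_of_lt hb hk) (div_lt_of_lt hb hk')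
    (mark_inj (by omega) (by omega) h1)
  have := Nat.mod_lt k hb
  have := Nat.mod_lt k' hb
  exact ⟨eq_of_div_mod h4 (by omega), h3⟩

/-- Strings of the three matrices that spell the beginning of a piece come from a triangle. -/
theorem triangle_of_eq {A B C : ℕ → ℕ → ℕ} {i j j' k k' i' z : ℕ} {s s' : List ℕ}
    (hj : j < r * b) (hk : k < r * b) (hk' : k' < r * b)
    (h : leftString r b A i j ++ (midString r b B j' k ++ (rightString r b C k' i' ++ s)) =
      piece r b z ++ s') :
    i = i' ∧ j = j' ∧ k = k' ∧ A i j ≠ 0 ∧ B j k ≠ 0 ∧ C k i ≠ 0 := by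
  simp only [leftString, midString, rightString, piece, List.cons_append, List.append_assoc,
    List.cons.injEq, List.nil_append] at h
  obtain ⟨h1, h⟩ := h
  -- The two runs of zeros merge; comparing with the piece gives `j % b + (b - j' % b) = b`. The
  -- same is then done for `k` and `k'`.
  rw [← List.append_assoc, List.replicate_append_replicate] at h
  obtain ⟨h2, h3, h⟩ := replicate_append_cons_inj (mark_ne_zero (by omega)) (by omega) h
  rw [← List.append_assoc, List.replicate_append_replicate] at h
  obtain ⟨h4, h5, -⟩ := replicate_append_cons_inj (mark_ne_zero (by omega)) (by omega) h
  obtain ⟨hA, h1⟩ := mark_eq (by omega) (by omega) h1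
  obtain ⟨hB, h3⟩ := mark_eq (by omega) (by omega) h3
  obtain ⟨hC, h5⟩ := mark_eq (by omega) (by omega) h5
  have hr : 0 < r := Nat.pos_of_mul_pos_right (by omega : 0 < r * b)
  have hmod := Nat.mod_lt z hr
  -- In base `r`, with an unbounded leading digit, `z` consists of a row and two blocks. Each
  -- nonzero letter of the piece shows two of the three, so any two matrix strings are compared in
  -- the digit that they share.
  have e1 : z / r = z / (r * r) * r + z / r % r := by
    rw [← Nat.div_div_eq_div_mul, Nat.div_add_mod']
  have e3 : z % (r * r) = z / r % r * r + z % r := by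
    rw [Nat.mod_mul, add_comm, mul_comm]
  obtain ⟨h6, h7⟩ := eq_of_mul_add_eq (div_lt_of_lt hb hj) (Nat.mod_lt _ hr) (h1.trans e1)
  obtain ⟨h8, h9⟩ := eq_of_mul_add_eq (div_lt_of_lt hb hk) hmod (h3.trans e3)
  obtain ⟨h10, h11⟩ := eq_of_mul_add_eq (div_lt_of_lt hb hk') hmod h5
  have := Nat.mod_lt j' hb
  have := Nat.mod_lt k' hb
  obtain rfl : i = i' := h6.trans h10.symm
  obtain rfl : j = j' := eq_of_div_mod (h7.trans h8.symm) (by omega)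
  obtain rfl : k = k' := eq_of_div_mod (h9.trans h11.symm) (by omega)
  exact ⟨rfl, rfl, rfl, hA, hB, hC⟩

/-- The piece is the one whose number has the digits `i`, `j / b`, `k / b`; equal offsets make both
runs of zeros add up to `b`. -/
theorem eq_of_triangle {A B C : ℕ → ℕ → ℕ} {i j k : ℕ}
    (hj : j < r * b) (hk : k < r * b) (hA : A i j ≠ 0) (hB : B j k ≠ 0) (hC : C k i ≠ 0) :
    leftString r b A i j ++ (midString r b B j k ++ rightString r b C k i) =
      piece r b ((i * r + j / b) * r + k / b) := by
  have hj' := div_lt_of_lt hb hj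
  have hk' := div_lt_of_lt hb hk
  have hr : 0 < r := Nat.zero_lt_of_lt hj'
  have e1 : ((i * r + j / b) * r + k / b) / r = i * r + j / b := by
    rw [mul_comm, Nat.mul_add_div hr, Nat.div_eq_of_lt hk', add_zero]
  have e2 : ((i * r + j / b) * r + k / b) % r = k / b := by
    rw [Nat.mul_add_mod', Nat.mod_eq_of_lt hk']
  have e3 : ((i * r + j / b) * r + k / b) / (r * r) = i := by
    rw [← Nat.div_div_eq_div_mul, e1, mul_comm, Nat.mul_add_div hr, Nat.div_eq_of_lt hj', add_zero]
  have e4 : ((i * r + j / b) * r + k / b) % (r * r) = j / b * r + k / b := by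
    rw [Nat.mod_mul, e2, e1, Nat.mul_add_mod', Nat.mod_eq_of_lt hj', add_comm, mul_comm]
  have hj'' := Nat.mod_lt j hb
  have hk'' := Nat.mod_lt k hb
  simp only [leftString, midString, rightString, piece, mark, hA, hB, hC, if_false, e1, e2, e3, e4,
    List.cons_append, List.append_assoc]
  rw [← List.append_assoc (List.replicate (j % b) 0), List.replicate_append_replicate,
    ← List.append_assoc (List.replicate (k % b) 0), List.replicate_append_replicate,
    Nat.add_sub_cancel' hj''.le, Nat.add_sub_cancel' hk''.le]

end

/-- The segments of the matrices. -/
def matrixSegments (r b : ℕ) (A B C : ℕ → ℕ → ℕ) : List (List (List ℕ)) :=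
  [grid (r * b) (leftString r b A), grid (r * b) (midString r b B), grid (r * b) (rightString r b C)]

/-- The segments of the text between the two ends. -/
def core (r b D : ℕ) (A B C : ℕ → ℕ → ℕ) : List (List (List ℕ)) :=
  skipBefore r b D D ++ (matrixSegments r b A B C ++ skipAfter r b D D)

/-- The segments before the matrices spell whole pieces, so the matrix strings start at a piece
boundary and `triangle_of_eq` applies; neither the number of skipped pieces nor the rest of the
pattern matters. Conversely, the piece of a triangle is spelled by the matrices, and all pieces
around it can be skipped. The condition `hD` says that there is one piece for each row and two
blocks. -/
theorem spells_core_iff {r b D : ℕ} (hr : 0 < r) (hb : 0 < b) (hD : r * b * r * r = r ^ D)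
    (A B C : ℕ → ℕ → ℕ) : Spells (core r b D A B C) (pieces r b 0 (r ^ D)) ↔
      ∃ i < r * b, ∃ j < r * b, ∃ k < r * b, A i j ≠ 0 ∧ B j k ≠ 0 ∧ C k i ≠ 0 := by
  simp only [core, spells_append, matrixSegments, Spells, mem_grid]
  constructor
  · rintro ⟨p, _, h, hp, _, s, rfl, ⟨_, ⟨i, hi, j, hj, rfl⟩, _, rfl, _, ⟨j', hj', k, hk, rfl⟩, _,
      rfl, _, ⟨k', hk', i', hi', rfl⟩, _, rfl, rfl⟩, hs⟩
    obtain ⟨zs, rfl⟩ := hp.exists_flatMap_piece fun R hR u hu => by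
      obtain ⟨t, rfl⟩ := mem_skipBefore hR
      exact exists_of_mem_skipSegment hu
    obtain ⟨ws, hws⟩ := exists_of_flatMap_piece_append h.symm
    cases ws with
    | nil => simp [leftString] at hws
    | cons z ws =>
      simp only [List.append_nil, List.append_assoc, List.flatMap_cons] at hws
      obtain ⟨rfl, rfl, rfl, hA, hB, hC⟩ := triangle_of_eq hb hj hk hk' hws
      exact ⟨i, hi, j, hj, k, hk, hA, hB, hC⟩
  · rintro ⟨i, hi, j, hj, k, hk, hA, hB, hC⟩
    set z := (i * r + j / b) * r + k / b with hz
    have hlt : z < r ^ D := by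
      have h1 := div_lt_of_lt hb hj
      have h2 := div_lt_of_lt hb hk
      have h3 : i * r + j / b + 1 ≤ r * b * r := by nlinarith
      rw [← hD]
      nlinarith
    have hsplit : pieces r b 0 (r ^ D) = pieces r b 0 z ++ (piece r b z ++
        pieces r b (z + 1) (r ^ D - z - 1)) := by
      have h1 := pieces_add r b 0 z (1 + (r ^ D - z - 1))
      rw [pieces_add r b (0 + z), pieces_one, Nat.zero_add] at h1
      rw [← h1]
      congr 1; omega
    refine ⟨_, _, hsplit, ?_, _, _, rfl, ⟨_, ⟨i, hi, j, hj, rfl⟩, _, ?_, _, ⟨j, hj, k, hk, rfl⟩, _,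
      rfl, _, ⟨k, hk, i, hi, rfl⟩, [], rfl, rfl⟩, ?_⟩
    · simpa using! spells_skipBefore (b := b) le_rfl hr 0 z hlt (by simp)
    · rw [List.append_nil]
      exact (eq_of_triangle hb hj hk hA hB hC).symm
    · clear_value z
      exact spells_skipAfter le_rfl hr 0 _ _ (by omega) (by omega) (by simp)

/-! ### The instance made from three matrices -/

/-- The text. -/
def text (r b D : ℕ) (A B C : ℕ → ℕ → ℕ) : Data := [[4]] :: (core r b D A B C ++ [[[8]]])

theorem pattern_eq (r b Z : ℕ) : pattern r b Z = 4 :: (pieces r b 0 Z ++ [8]) := by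
  rw [pattern, pieces, List.range_eq_range']

theorem map_inst_fixed (L : ℕ → ℕ) (s : List ℕ) : (fixed s).map (Cell.inst L) = s := by
  simp [fixed, Cell.inst, Function.comp_def]

theorem instantiate_fixed (L : ℕ → ℕ) (Y : List (List (List ℕ))) :
    instantiate L (Y.map (List.map fixed)) = Y := by
  simp [instantiate, Function.comp_def, map_inst_fixed]

theorem map_grid {α β : Type*} (f : α → β) (m : ℕ) (g : ℕ → ℕ → α) :
    (grid m g).map f = grid m fun i j => f (g i j) := by
  simp [grid, List.map_flatMap, Function.comp_def]

theorem instantiate_blockTemplate (L : ℕ → ℕ) (q n r b : ℕ) :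
    instantiate L (blockTemplate q n r b (r * b)) =
      [pattern r b (r ^ (q + 2))] :: text r b (q + 2) (fun i j => L (cellOf n 0 i j))
        (fun j k => L (cellOf n 1 j k)) (fun k i => L (cellOf n 2 k i)) := by
  have happ : ∀ X Y, instantiate L (X ++ Y) = instantiate L X ++ instantiate L Y := fun X Y =>
    List.map_append
  have hone : ∀ g, instantiate L [g] = [g.map fun s => s.map (Cell.inst L)] := fun g => rfl
  simp only [blockTemplate, happ, instantiate_fixed, hone]
  simp only [map_grid, List.map_cons, List.map_nil,
    List.map_append, map_inst_fixed, text, core, matrixSegments, List.cons_append,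
    List.nil_append, List.append_assoc]
  rfl

theorem mark_mod {a v tag : ℕ} (h : tag ≠ 0) (h' : tag < 4) : mark a v tag ≠ 4 ∧ mark a v tag ≠ 8 := by
  unfold mark; split <;> omega

theorem not_mem_piece {r b z x : ℕ} (hx : x ≠ 0) (h4 : x % 4 = 0) : x ∉ piece r b z := by
  simp only [piece, List.mem_cons, List.mem_append, List.mem_replicate, List.not_mem_nil,
    or_false]
  omega

/-- Nonzero letters of pieces and markers of nonzero entries are not divisible by 4, and markers of
zero entries are at least 12. This leaves 4 and 8 for the ends. -/
theorem not_mem_core {r b D : ℕ} {A B C : ℕ → ℕ → ℕ} {x : ℕ} (hx : x = 4 ∨ x = 8) :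
    ∀ R ∈ core r b D A B C, ∀ u ∈ R, x ∉ u := by
  have hskip : ∀ t, ∀ u ∈ skipSegment r b D t, x ∉ u := fun t u hu => by
    obtain ⟨zs, rfl⟩ := exists_of_mem_skipSegment hu
    simp only [List.mem_flatMap, not_exists, not_and]
    exact fun z _ => not_mem_piece (by omega) (by omega)
  have hmark : ∀ a v tag, tag ≠ 0 → tag < 4 → x ≠ mark a v tag := fun a v tag h h' => by
    have := mark_mod (a := a) (v := v) h h'
    omega
  intro R hR u hu
  simp only [core, List.mem_append] at hR
  rcases hR with hR | hR | hR
  · obtain ⟨t, rfl⟩ := mem_skipBefore hR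
    exact hskip t u hu
  · simp only [matrixSegments, List.mem_cons, List.not_mem_nil, or_false] at hR
    rcases hR with rfl | rfl | rfl <;> obtain ⟨i, -, j, -, rfl⟩ := mem_grid.1 hu
    · have := hmark (A i j) (i * r + j / b) 1 (by omega) (by omega)
      simp only [leftString, List.mem_cons, List.mem_replicate]
      omega
    · have := hmark (B i j) (i / b * r + j / b) 2 (by omega) (by omega)
      simp only [midString, List.mem_append, List.mem_cons, List.mem_replicate]
      omega
    · have := hmark (C i j) (j * r + i / b) 3 (by omega) (by omega)
      simp only [rightString, List.mem_append, List.mem_cons, List.mem_replicate, List.not_mem_nil,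
        or_false]
      omega
  · obtain ⟨t, rfl⟩ := mem_skipAfter hR
    exact hskip t u hu

theorem exists_occEndsAt_text_iff {r b D : ℕ} (hr : 0 < r) (hb : 0 < b)
    (hD : r * b * r * r = r ^ D) (A B C : ℕ → ℕ → ℕ) :
    (∃ j < (text r b D A B C).length, OccEndsAt (pattern r b (r ^ D)) (text r b D A B C) j) ↔
      ∃ i < r * b, ∃ j < r * b, ∃ k < r * b, A i j ≠ 0 ∧ B j k ≠ 0 ∧ C k i ≠ 0 := by
  rw [← spells_core_iff hr hb hD, pattern_eq, text]
  exact exists_occEndsAt_iff (by omega) (not_mem_core (.inl rfl)) (not_mem_core (.inr rfl))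

theorem length_pattern (r b Z : ℕ) : (pattern r b Z).length = Z * (2 * b + 3) + 2 := by
  simp [pattern_eq, length_pieces]

theorem le_textSize_of_mem {T : Data} {R : List (List ℕ)} (h : R ∈ T) :
    R.flatten.length ≤ textSize T := by
  obtain ⟨T₁, T₂, rfl⟩ := List.append_of_mem h
  simp only [textSize, List.flatten_append, List.flatten_cons, List.length_append]
  omega

theorem isInstance_text {r b D : ℕ} (hr : 0 < r) (hb : 0 < b) (hD : 0 < D) (A B C : ℕ → ℕ → ℕ) :
    IsInstance (pattern r b (r ^ D)) (text r b D A B C) := by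
  refine ⟨by simp [pattern], fun S hS => ?_, ?_⟩
  · have hpos : 0 < r * b := Nat.mul_pos hr hb
    have hskip : ∀ t, skipSegment r b D t ≠ [] ∧ (skipSegment r b D t).Nodup := fun t =>
      ⟨by simp [skipSegment], nodup_skipSegment hr⟩
    have hgrid : ∀ g : ℕ → ℕ → List ℕ, grid (r * b) g ≠ [] := fun g =>
      List.ne_nil_of_mem (mem_grid.2 ⟨0, hpos, 0, hpos, rfl⟩)
    simp only [text, core, List.mem_cons, List.mem_append, matrixSegments, List.not_mem_nil,
      or_false] at hS
    rcases hS with rfl | (hS | (rfl | rfl | rfl) | hS) | rfl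
    · simp
    · obtain ⟨t, rfl⟩ := mem_skipBefore hS
      exact hskip t
    · exact ⟨hgrid _, nodup_grid fun i _ j hj i' _ j' hj' => leftString_inj hb hj hj'⟩
    · exact ⟨hgrid _, nodup_grid fun i _ j hj i' _ j' hj' => midString_inj hb hj hj'⟩
    · exact ⟨hgrid _, nodup_grid fun i hi j _ i' hi' j' _ => rightString_inj hb hi hi'⟩
    · obtain ⟨t, rfl⟩ := mem_skipAfter hS
      exact hskip t
    · simp
  · have hmem : skipSegment r b D 0 ∈ core r b D A B C :=
      List.mem_append_left _ (skipSegment_zero_mem hr hD)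
    have hle := le_textSize_of_mem hmem
    have hlen : (skipSegment r b D 0).flatten.length = r ^ D * (2 * b + 3) := by
      simp [skipSegment, List.length_flatten, Function.comp_def, chunk_eq_pieces, length_pieces]
    have htext : textSize (text r b D A B C) = textSize (core r b D A B C) + 2 := by
      simp only [textSize, text, List.flatten_cons, List.flatten_append, List.length_append,
        List.length_cons, List.length_nil, List.flatten_nil]
      omega
    rw [length_pattern, htext]
    omega

theorem length_skipBefore (r b D t : ℕ) : (skipBefore r b D t).length = t * r := by
  induction t with
  | zero => simp [skipBefore]
  | succ t ih => simp [skipBefore, ih, Nat.succ_mul, Nat.add_comm]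

theorem length_skipAfter (r b D t : ℕ) : (skipAfter r b D t).length = t * r := by
  induction t with
  | zero => simp [skipAfter]
  | succ t ih => simp [skipAfter, ih, Nat.succ_mul]

theorem length_text (r b D : ℕ) (A B C : ℕ → ℕ → ℕ) :
    (text r b D A B C).length = 2 * D * r + 5 := by
  simp only [text, core, matrixSegments, List.length_cons, List.length_append, List.length_nil,
    length_skipBefore, length_skipAfter]
  ring

/-! ### The entries of the matrices in the input -/

theorem getD_flatten {n : ℕ} {l : List (List ℕ)} (hl : ∀ s ∈ l, s.length = n) (i j : ℕ)
    (hj : j < n) : l.flatten.getD (i * n + j) 0 = (l.getD i []).getD j 0 := by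
  induction l generalizing i with
  | nil => simp
  | cons s l ih =>
    have hs : s.length = n := hl s (by simp)
    cases i with
    | zero =>
      rw [List.flatten_cons, List.getD_append _ _ _ _ (by omega)]
      simp
    | succ i =>
      rw [List.flatten_cons, List.getD_append_right _ _ _ _ (by rw [hs, Nat.succ_mul]; omega), hs,
        show (i + 1) * n + j - n = i * n + j by rw [Nat.succ_mul]; omega,
        ih fun s h => hl s (by simp [h])]
      rfl

theorem length_rows {n : ℕ} (A : Matrix (Fin n) (Fin n) Bool) : (rows A).length = n := by
  simp [rows]

theorem length_of_mem_rows {n : ℕ} {A : Matrix (Fin n) (Fin n) Bool} {s : List ℕ}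
    (h : s ∈ rows A) : s.length = n := by
  simp only [rows, List.mem_ofFn] at h
  obtain ⟨i, rfl⟩ := h
  simp

theorem getD_rows {n : ℕ} (A : Matrix (Fin n) (Fin n) Bool) (i j : Fin n) :
    ((rows A).getD i []).getD j 0 = (A i j).toNat := by
  simp [rows, List.getD_eq_getElem?_getD]

section
variable {n : ℕ} (A B C : Matrix (Fin n) (Fin n) Bool)

theorem letters_rows : letters [rows A, rows B, rows C] = (rows A ++ (rows B ++ rows C)).flatten := by
  simp [letters]

theorem length_letters_rows : (letters [rows A, rows B, rows C]).length = 3 * (n * n) := by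
  have h : ∀ A : Matrix (Fin n) (Fin n) Bool, (rows A).flatten.length = n * n := fun A => by
    simp [rows, List.length_flatten, List.map_ofFn, Function.comp_def]
  rw [letters_rows]
  simp only [List.flatten_append, List.length_append, h]
  omega

/-- Within range, `cellOf` points into row `base * n + i` of the stacked matrices. Otherwise it
points past the last letter, where the default 0 provides the padding. -/
theorem letters_rows_getD (base : Fin 3) (i j : ℕ) :
    (letters [rows A, rows B, rows C]).getD (cellOf n base i j) 0 ≠ 0 ↔
      ∃ i' j' : Fin n, (i' : ℕ) = i ∧ (j' : ℕ) = j ∧ ![A, B, C] base i' j' = true := by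
  by_cases h : i < n ∧ j < n
  · obtain ⟨hi, hj⟩ := h
    have hcell : cellOf n base i j = (base * n + i) * n + j := by
      rw [cellOf, if_neg (by omega), if_neg (by omega)]; ring
    have hlen : ∀ s ∈ rows A ++ (rows B ++ rows C), s.length = n := by
      simp only [List.mem_append]
      rintro s (h | h | h) <;> exact length_of_mem_rows h
    have hget : (rows A ++ (rows B ++ rows C)).getD (base * n + i) [] =
        (rows (![A, B, C] base)).getD i [] := by
      have hA := length_rows A
      have hB := length_rows B
      fin_cases base
      · simp only [Fin.zero_eta, Matrix.cons_val_zero]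
        rw [List.getD_append _ _ _ _ (by omega), Nat.zero_mul, Nat.zero_add]
      · simp only [Fin.mk_one, Matrix.cons_val_one, Matrix.cons_val_zero]
        rw [List.getD_append_right _ _ _ _ (by omega), List.getD_append _ _ _ _ (by omega)]
        congr 1; omega
      · simp only [Fin.reduceFinMk, Matrix.cons_val]
        rw [List.getD_append_right _ _ _ _ (by omega), List.getD_append_right _ _ _ _ (by omega)]
        congr 1; omega
    rw [letters_rows, hcell, getD_flatten hlen _ _ hj, hget, getD_rows _ ⟨i, hi⟩ ⟨j, hj⟩]
    constructor
    · intro h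
      exact ⟨⟨i, hi⟩, ⟨j, hj⟩, rfl, rfl, by simpa using h⟩
    · rintro ⟨i', j', rfl, rfl, h⟩
      simpa using h
  · have hbig : 3 * (n * n) ≤ cellOf n base i j := by
      rw [cellOf]
      have : 1 ≤ (if n < i + 1 then 1 else 0) + if n < j + 1 then 1 else 0 := by
        split <;> split <;> omega
      exact le_add_of_nonneg_of_le (by omega) (Nat.le_mul_of_pos_right _ this)
    rw [List.getD_eq_default _ _ (by rw [length_letters_rows]; exact hbig)]
    simp only [ne_eq, not_true_eq_false, false_iff, not_exists, not_and]
    rintro i' j' rfl rfl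
    exact absurd ⟨i'.2, j'.2⟩ h

theorem order_rows : order [rows A, rows B, rows C] = n := by
  simp [order, length_rows]

theorem exists_triangle_iff {m : ℕ} (hm : n ≤ m) :
    (∃ i < m, ∃ j < m, ∃ k < m, (letters [rows A, rows B, rows C]).getD (cellOf n 0 i j) 0 ≠ 0 ∧
      (letters [rows A, rows B, rows C]).getD (cellOf n 1 j k) 0 ≠ 0 ∧
      (letters [rows A, rows B, rows C]).getD (cellOf n 2 k i) 0 ≠ 0) ↔
    ∃ i j k, A i j = true ∧ B j k = true ∧ C k i = true := by
  have h0 := letters_rows_getD A B C 0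
  have h1 := letters_rows_getD A B C 1
  have h2 := letters_rows_getD A B C 2
  simp only [Fin.val_zero, Fin.val_one, Fin.val_two, Matrix.cons_val_zero, Matrix.cons_val_one,
    Matrix.cons_val] at h0 h1 h2
  simp only [h0, h1, h2]
  constructor
  · rintro ⟨_, -, _, -, _, -, ⟨i, j, rfl, rfl, hA⟩, ⟨j', k, hj, rfl, hB⟩, ⟨k', i', hk, hi, hC⟩⟩
    obtain rfl := Fin.ext hj
    obtain rfl := Fin.ext hk
    obtain rfl := Fin.ext hi
    exact ⟨i', j', k', hA, hB, hC⟩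
  · rintro ⟨i, j, k, hA, hB, hC⟩
    exact ⟨i, by omega, j, by omega, k, by omega, ⟨i, j, rfl, rfl, hA⟩, ⟨j, k, rfl, rfl, hB⟩,
      ⟨k, i, rfl, rfl, hC⟩⟩

end

/-! ### The choice of the parameters -/

/-- The generator has no operation for roots; it tries every `x < n`. By this and `root_unique`
exactly one passes the guards. -/
theorem exists_root {n q : ℕ} (hn : 1 ≤ n) (hq : q ≠ 0) :
    ∃ x < n, x ^ q < n ∧ n < (x + 1) ^ q + 1 := by
  have hex : ∃ k, n ≤ k ^ q := ⟨n, Nat.le_self_pow hq n⟩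
  obtain ⟨x, hx⟩ : ∃ x, Nat.find hex = x + 1 := Nat.exists_eq_succ_of_ne_zero fun h0 => by
    have := Nat.find_spec hex
    rw [h0, zero_pow hq] at this
    omega
  have h1 := Nat.find_spec hex
  have h2 := Nat.find_min hex (show x < Nat.find hex by omega)
  rw [hx] at h1
  exact ⟨x, (Nat.le_self_pow hq x).trans_lt (by omega), by omega, by omega⟩

theorem root_unique {n q x y : ℕ} (hx : x ^ q < n ∧ n < (x + 1) ^ q + 1)
    (hy : y ^ q < n ∧ n < (y + 1) ^ q + 1) : x = y := by
  rcases Nat.lt_trichotomy x y with h | h | h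
  · have := Nat.pow_le_pow_left (show x + 1 ≤ y from h) q
    omega
  · exact h
  · have := Nat.pow_le_pow_left (show y + 1 ≤ x from h) q
    omega

theorem flatMap_range_ite {α : Type*} {p : ℕ → Prop} [DecidablePred p] (g : ℕ → List α) {x : ℕ}
    (hx : p x) (huniq : ∀ y, p y → y = x) (n : ℕ) :
    ((List.range n).flatMap fun y => if p y then g y else []) = if x < n then g x else [] := by
  induction n with
  | zero => simp
  | succ n ih =>
    rw [List.range_succ, List.flatMap_append, ih]
    by_cases hn : p n
    · obtain rfl := huniq n hn
      simp [hn]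
    · have : x ≠ n := fun h => hn (h ▸ hx)
      simp only [List.flatMap_cons, List.flatMap_nil, if_neg hn, List.append_nil]
      exact if_congr (by omega) rfl rfl

theorem template_eq {n q x : ℕ} (hxn : x < n) (hx : x ^ q < n ∧ n < (x + 1) ^ q + 1) :
    template q n = blockTemplate q n (x + 1) ((x + 1) ^ (q - 1)) ((x + 1) ^ q) := by
  rw [template, flatMap_range_ite _ hx (fun y hy => root_unique hy hx), if_pos hxn]

/-! ### The work of the generator -/

theorem work_zeros (e : Arith) (env : List ℕ) : (zeros e).work env = 1 + 2 * e.eval env := by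
  simp [zeros, Gen.work, emitFixed, mul_comm]

theorem work_pieceGen {z : Arith} {env : List ℕ} {b : ℕ} (hb : env.getD 3 0 = b) :
    (pieceGen z).work env = 4 * b + 5 := by
  subst hb
  simp only [pieceGen, Gen.work, work_zeros, emitFixed, Arith.eval_var]
  ring

theorem work_loop_le {e : Arith} {G : Gen} {env : List ℕ} {W : ℕ}
    (h : ∀ i < e.eval env, G.work (env ++ [i]) ≤ W) :
    (Gen.loop e G).work env ≤ 1 + e.eval env * (1 + W) := by
  rw [Gen.work]
  refine Nat.add_le_add_left ?_ 1
  calc _ ≤ ∑ _i ∈ Finset.range (e.eval env), (1 + W) :=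
        Finset.sum_le_sum fun i hi => Nat.add_le_add_left (h i (Finset.mem_range.1 hi)) 1
    _ = _ := by simp

theorem work_patternGen (D n x r b m : ℕ) :
    (patternGen D).work [n, x, r, b, m] = r ^ D * (4 * b + 6) + 5 := by
  have h : ∀ z, (pieceGen (.var 5)).work [n, x, r, b, m, z] = 4 * b + 5 := fun z =>
    work_pieceGen rfl
  simp only [patternGen, Gen.work, emitFixed, endBoth, List.cons_append, List.nil_append, h,
    Arith.eval_power, Arith.eval_var, List.getD_cons_succ, List.getD_cons_zero,
    Finset.sum_const, Finset.card_range, smul_eq_mul]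
  ring

/-- At every level `t`, each of the `r` copies lists all `r ^ D` pieces, of length `O(b)`. -/
theorem work_skipGen_le {D t : ℕ} (ht : t ≤ D) (n x : ℕ) {r b : ℕ} (m : ℕ) (hr : 0 < r)
    (hb : 0 < b) : (skipGen D t).work [n, x, r, b, m] ≤ 18 * (r * (r ^ D * b)) := by
  have h : ∀ i c u, (pieceGen (.var 6 * Arith.power (.var 2) t + .var 7)).work
      [n, x, r, b, m, i, c, u] = 4 * b + 5 := fun i c u => work_pieceGen rfl
  simp only [skipGen, Gen.work, List.cons_append, List.nil_append, h,
    Arith.eval_power, Arith.eval_var, List.getD_cons_succ, List.getD_cons_zero,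
    Finset.sum_const, Finset.card_range, smul_eq_mul]
  have hpow : r ^ (D - t) * r ^ t = r ^ D := by rw [← pow_add, Nat.sub_add_cancel ht]
  have h1 : 1 ≤ r ^ t := Nat.pow_pos hr
  have h2 : 1 ≤ r ^ (D - t) := Nat.pow_pos hr
  set p := r ^ (D - t)
  set s := r ^ t
  have hps : 1 ≤ p * s := Nat.mul_pos h2 h1
  have hp : p ≤ p * s := Nat.le_mul_of_pos_right _ h1
  have hpsb : p * s ≤ p * s * b := Nat.le_mul_of_pos_right _ hb
  have hX : 1 + (1 + (1 + p * (1 + (1 + s * (1 + (4 * b + 5)) + 1)) + 1)) ≤ 17 * (p * s * b) := by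
    have : p * (1 + (1 + s * (1 + (4 * b + 5)) + 1)) = 3 * p + 6 * (p * s) + 4 * (p * s * b) := by
      ring
    omega
  rw [← hpow]
  have hr' : 1 ≤ r * (p * s * b) := Nat.mul_pos hr (by omega)
  have := Nat.mul_le_mul_left r hX
  nlinarith

theorem work_skipBeforeGen_le {D t : ℕ} (ht : t ≤ D) (n x : ℕ) {r b : ℕ} (m : ℕ) (hr : 0 < r)
    (hb : 0 < b) :
    (skipBeforeGen D t).work [n, x, r, b, m] ≤ 1 + t * (18 * (r * (r ^ D * b))) := by
  induction t with
  | zero => simp [skipBeforeGen, Gen.work]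
  | succ t ih =>
    have h1 := work_skipGen_le (show t ≤ D by omega) n x m hr hb
    have h2 := ih (by omega)
    rw [skipBeforeGen, Gen.work, Nat.succ_mul]
    omega

theorem work_skipAfterGen_le {D t : ℕ} (ht : t ≤ D) (n x : ℕ) {r b : ℕ} (m : ℕ) (hr : 0 < r)
    (hb : 0 < b) :
    (skipAfterGen D t).work [n, x, r, b, m] ≤ 1 + t * (18 * (r * (r ^ D * b))) := by
  induction t with
  | zero => simp [skipAfterGen, Gen.work]
  | succ t ih =>
    have h1 := work_skipGen_le (show t ≤ D by omega) n x m hr hb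
    have h2 := ih (by omega)
    rw [skipAfterGen, Gen.work, Nat.succ_mul]
    omega

theorem work_gridGen_le {G : Gen} {n x r b m : ℕ} (hb : 0 < b) (hm : 0 < m)
    (h : ∀ i j, G.work [n, x, r, b, m, i, j] ≤ 4 * b + 3) :
    (gridGen G).work [n, x, r, b, m] ≤ 13 * (m * m * b) := by
  have h1 : (Gen.loop (.var 4) (.loop (.var 4) (.seq G .endString))).work [n, x, r, b, m] ≤
      1 + m * (1 + (1 + m * (1 + (4 * b + 4)))) := by
    refine work_loop_le fun i _ => ?_
    refine work_loop_le fun j _ => ?_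
    exact Nat.add_le_add_right (h i j) 1
  rw [gridGen, Gen.work, Gen.work]
  have h2 : 1 ≤ m * b := Nat.mul_pos hm hb
  have h3 : m ≤ m * m := Nat.le_mul_of_pos_right _ hm
  have h4 : m * m ≤ m * m * b := Nat.le_mul_of_pos_right _ hb
  have h5 : m * (1 + (1 + m * (1 + (4 * b + 4)))) = 2 * m + 5 * (m * m) + 4 * (m * m * b) := by ring
  omega

theorem work_matrixGen_le {n x r b m : ℕ} (hb : 0 < b) (hm : 0 < m) :
    matrixGen.work [n, x, r, b, m] ≤ 39 * (m * m * b) := by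
  have hmod : ∀ i, i % b ≤ b := fun i => (Nat.mod_lt i hb).le
  have h1 := @work_gridGen_le (.seq (markerGen 0 (.var 5 * .var 2 + .var 6 / .var 3) 1)
    (zeros (.var 6 % .var 3))) n x r b m hb hm fun i j => by
      simp only [Gen.work, markerGen, work_zeros, Arith.eval_mod, Arith.eval_var,
        List.getD_cons_succ, List.getD_cons_zero]
      have := hmod j; omega
  have h2 := @work_gridGen_le (.seq (zeros (.var 3 - .var 5 % .var 3))
    (.seq (markerGen 1 (.var 5 / .var 3 * .var 2 + .var 6 / .var 3) 2)
      (zeros (.var 6 % .var 3)))) n x r b m hb hm fun i j => by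
      simp only [Gen.work, markerGen, work_zeros, Arith.eval_mod, Arith.eval_sub, Arith.eval_var,
        List.getD_cons_succ, List.getD_cons_zero]
      have := hmod j; omega
  have h3 := @work_gridGen_le (.seq (zeros (.var 3 - .var 5 % .var 3))
    (markerGen 2 (.var 6 * .var 2 + .var 5 / .var 3) 3)) n x r b m hb hm fun i j => by
      simp only [Gen.work, markerGen, work_zeros, Arith.eval_mod, Arith.eval_sub, Arith.eval_var,
        List.getD_cons_succ, List.getD_cons_zero]
      omega
  rw [matrixGen, Gen.work, Gen.work]
  omega

/-- The matrices dominate, with `r ^ (2 * q)` strings each of length `O(r ^ (q - 1))`. Skipping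
costs `O(r ^ (2 * q + 2))` per level, which is within the bound because `q ≥ 3`. -/
theorem work_blockGen_le {q r : ℕ} (hq : 3 ≤ q) (hr : 0 < r) (n x : ℕ) :
    (blockGen (q + 2)).work [n, x, r, r ^ (q - 1), r ^ q] ≤ (36 * q + 140) * r ^ (3 * q - 1) := by
  have hb : 0 < r ^ (q - 1) := Nat.pow_pos hr
  have hm : 0 < r ^ q := Nat.pow_pos hr
  have h1 := work_patternGen (q + 2) n x r (r ^ (q - 1)) (r ^ q)
  have h2 := work_skipBeforeGen_le (le_refl (q + 2)) n x (r ^ q) hr hb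
  have h3 := work_skipAfterGen_le (le_refl (q + 2)) n x (r ^ q) hr hb
  have h4 := work_matrixGen_le (n := n) (x := x) (r := r) hb hm
  have e1 : r ^ (q + 2) * r ^ (q - 1) ≤ r ^ (3 * q - 1) := by
    rw [← pow_add]; exact Nat.pow_le_pow_right hr (by omega)
  have e2 : r * (r ^ (q + 2) * r ^ (q - 1)) ≤ r ^ (3 * q - 1) := by
    rw [← pow_add, ← pow_succ']; exact Nat.pow_le_pow_right hr (by omega)
  have e3 : r ^ q * r ^ q * r ^ (q - 1) = r ^ (3 * q - 1) := by
    rw [← pow_add, ← pow_add]; congr 1; omega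
  have e4 : r ^ (q + 2) ≤ r ^ (3 * q - 1) := Nat.pow_le_pow_right hr (by omega)
  have e5 : 1 ≤ r ^ (3 * q - 1) := Nat.pow_pos hr
  have h23 := Nat.mul_le_mul_left (q + 2) (Nat.mul_le_mul_left 18 e2)
  rw [e3] at h4
  simp only [blockGen, Gen.work, emitFixed, endBoth, h1]
  have e6 : r ^ (q + 2) * (4 * r ^ (q - 1) + 6) = 4 * (r ^ (q + 2) * r ^ (q - 1)) + 6 * r ^ (q + 2) :=
    by ring
  have e7 : (q + 2) * (18 * r ^ (3 * q - 1)) = 18 * (q * r ^ (3 * q - 1)) + 36 * r ^ (3 * q - 1) := by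
    ring
  have e8 : (36 * q + 140) * r ^ (3 * q - 1) = 36 * (q * r ^ (3 * q - 1)) + 140 * r ^ (3 * q - 1) := by
    ring
  omega

/-- Searching for the root costs `O(n)`, and a single `x` runs the block. -/
theorem work_instanceGen_le {n q x : ℕ} (hq : 3 ≤ q) (hxn : x < n)
    (hx : x ^ q < n ∧ n < (x + 1) ^ q + 1) :
    (instanceGen q).work [n] ≤ (36 * q + 150) * (x + 1) ^ (3 * q - 1) := by
  set W := (36 * q + 140) * (x + 1) ^ (3 * q - 1) with hW
  have hn : n ≤ (x + 1) ^ (3 * q - 1) :=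
    (show n ≤ (x + 1) ^ q by omega).trans (Nat.pow_le_pow_right (by omega) (by omega))
  have hterm : ∀ y ∈ Finset.range n, (1 + (1 + if (if y ^ q < n then 1 else 0) = 0 then 0 else
      1 + if (if n < (y + 1) ^ q + 1 then 1 else 0) = 0 then 0 else
        1 + (1 + (1 + (blockGen (q + 2)).work [n, y, y + 1, (y + 1) ^ (q - 1), (y + 1) ^ q])))) ≤
      3 + if y = x then 3 + W else 0 := by
    intro y _
    by_cases h₁ : y ^ q < n
    · by_cases h₂ : n < (y + 1) ^ q + 1
      · obtain rfl := root_unique ⟨h₁, h₂⟩ hx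
        have := work_blockGen_le hq (Nat.succ_pos y) n y
        simp only [h₁, h₂, if_true, one_ne_zero, if_false]
        simp only [Nat.succ_eq_add_one] at this
        omega
      · simp only [h₁, h₂, if_true, one_ne_zero, if_false]; omega
    · simp only [h₁, if_true, if_false]; omega
  have hsum : (instanceGen q).work [n] ≤ 1 + (n * 3 + (3 + W)) := by
    simp only [instanceGen, Gen.work, Arith.eval_lt, Arith.eval_power, Arith.eval_var,
      Arith.eval_add, Arith.eval_ofNat, List.cons_append, List.nil_append, List.getD_cons_succ,
      List.getD_cons_zero]
    refine Nat.add_le_add_left ((Finset.sum_le_sum hterm).trans ?_) 1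
    rw [Finset.sum_add_distrib, Finset.sum_ite_eq' , if_pos (Finset.mem_range.2 hxn)]
    simp
  have : (36 * q + 150) * (x + 1) ^ (3 * q - 1) = W + 10 * (x + 1) ^ (3 * q - 1) := by
    rw [hW]; ring
  have : 1 ≤ (x + 1) ^ (3 * q - 1) := Nat.pow_pos (Nat.succ_pos x)
  omega

/-! ### The size of the text -/

theorem length_dataTokens (X : List (List (List Cell))) :
    X.flatten.flatten.length ≤ (dataTokens X).length := by
  induction X with
  | nil => simp
  | cons g X ih =>
    have hg : g.flatten.length ≤ (groupTokens g).length := by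
      rw [groupTokens, List.length_append]
      refine le_trans ?_ (Nat.le_add_right _ _)
      induction g with
      | nil => simp
      | cons s g ih =>
        simp only [List.flatten_cons, List.flatMap_cons, List.length_append, stringTokens,
          List.length_map]
        omega
    simp only [dataTokens, List.flatten_cons, List.flatten_append, List.flatMap_cons,
      List.length_append] at ih ⊢
    omega

theorem textSize_le_work {q : ℕ} {x : Data} {P : List ℕ} {T : Data}
    (h : templateMap (template q) x = [P] :: T) : textSize T ≤ (instanceGen q).work [order x] := by
  refine le_trans ?_ (Gen.length_tokens_le_work _ _)
  rw [tokens_instanceGen]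
  refine le_trans ?_ (length_dataTokens _)
  have h1 := congrArg (fun D => (letters D).length) h
  simp only [templateMap, letters_instantiate, List.length_map] at h1
  rw [h1]
  simp [letters, textSize]

/-! ### The reduction -/

/-- Since `x` and 1 are both at most the `q`-th root of `n`, rounding the root up costs a factor of
at most 2. -/
theorem root_le {n q x : ℕ} (hq : q ≠ 0) (hn : 1 ≤ n) (hx : x ^ q < n) :
    ((x + 1 : ℕ) : ℝ) ≤ 2 * (n : ℝ) ^ ((q : ℝ)⁻¹) := by
  have h1 : (1 : ℝ) ≤ (n : ℝ) ^ ((q : ℝ)⁻¹) :=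
    Real.one_le_rpow (by exact_mod_cast hn) (by positivity)
  have h2 : (x : ℝ) ≤ (n : ℝ) ^ ((q : ℝ)⁻¹) := by
    rw [← Real.pow_rpow_inv_natCast (Nat.cast_nonneg x) hq]
    exact Real.rpow_le_rpow (by positivity) (by exact_mod_cast hx.le) (by positivity)
  push_cast
  linarith

theorem root_pow_le {n q x : ℕ} (hq : 3 ≤ q) (hn : 1 ≤ n) (hx : x ^ q < n) :
    (((x + 1) ^ (3 * q - 1) : ℕ) : ℝ) ≤ 2 ^ (3 * q - 1) * (n : ℝ) ^ (3 - (q : ℝ)⁻¹) := by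
  have hq0 : (q : ℝ) ≠ 0 := by positivity
  have h : (3 : ℝ) - (q : ℝ)⁻¹ = (q : ℝ)⁻¹ * ((3 * q - 1 : ℕ) : ℝ) := by
    rw [Nat.cast_sub (by omega)]
    push_cast
    field_simp
  rw [h, Real.rpow_mul_natCast (Nat.cast_nonneg n), ← mul_pow]
  push_cast
  have := root_le (by omega) hn hx
  push_cast at this
  exact pow_le_pow_left₀ (by positivity) this _

/-- The exponent of `r` is `(2 * q + 1) * (3 / 2 - 2 / q) = 3 * q - 5 / 2 - 2 / q`. Staying below `3
* q - 2` leaves room for the factor `O(r)` from the number of segments. -/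
theorem length_pattern_rpow_le {q r : ℕ} {ε : ℝ} (hq : 3 ≤ q) (hε : 2 / (q : ℝ) ≤ ε) (hr : 0 < r) :
    ((pattern r (r ^ (q - 1)) (r ^ (q + 2))).length : ℝ) ^ (3 / 2 - ε) ≤
      49 * (r : ℝ) ^ (3 * q - 2) := by
  have hr1 : (1 : ℝ) ≤ r := by exact_mod_cast hr
  have hq3 : (3 : ℝ) ≤ q := by exact_mod_cast hq
  have hq0 : (0 : ℝ) < q := by linarith
  -- Here `7 = 2 + 3 + 2`; the final constant is `49 = 7 ^ 2`, as the exponent is below 2.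
  have hlen : (pattern r (r ^ (q - 1)) (r ^ (q + 2))).length ≤ 7 * r ^ (2 * q + 1) := by
    rw [length_pattern]
    have e1 : r ^ (q + 2) * r ^ (q - 1) = r ^ (2 * q + 1) := by
      rw [← pow_add]; congr 1; omega
    have e2 : r ^ (q + 2) ≤ r ^ (2 * q + 1) := Nat.pow_le_pow_right hr (by omega)
    have e3 : 1 ≤ r ^ (2 * q + 1) := Nat.pow_pos hr
    have e4 : r ^ (q + 2) * (2 * r ^ (q - 1) + 3) =
      2 * (r ^ (q + 2) * r ^ (q - 1)) + 3 * r ^ (q + 2) := by ring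
    omega
  have hone : (1 : ℝ) ≤ ((pattern r (r ^ (q - 1)) (r ^ (q + 2))).length : ℝ) := by
    rw [length_pattern]; push_cast
    have : (0 : ℝ) ≤ (r : ℝ) ^ (q + 2) * (2 * (r : ℝ) ^ (q - 1) + 3) := by positivity
    linarith
  have hdiv : 2 / (q : ℝ) ≤ 2 / 3 := div_le_div_of_nonneg_left (by norm_num) (by norm_num) hq3
  have hdiv0 : 0 < 2 / (q : ℝ) := by positivity
  have hlen' : ((pattern r (r ^ (q - 1)) (r ^ (q + 2))).length : ℝ) ≤
      7 * (r : ℝ) ^ (2 * q + 1) := by exact_mod_cast hlen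
  -- Replacing `ε` by `2 / q ≤ 2 / 3` first makes the exponent positive, even if `ε` exceeds `3 /
  -- 2`, so that the base may then be enlarged.
  calc _ ≤ ((pattern r (r ^ (q - 1)) (r ^ (q + 2))).length : ℝ) ^ (3 / 2 - 2 / (q : ℝ)) :=
        Real.rpow_le_rpow_of_exponent_le hone (by linarith)
    _ ≤ (7 * (r : ℝ) ^ (2 * q + 1)) ^ (3 / 2 - 2 / (q : ℝ)) :=
        Real.rpow_le_rpow (by linarith) hlen' (by linarith)
    _ = 7 ^ (3 / 2 - 2 / (q : ℝ)) * (r : ℝ) ^ ((2 * q + 1) * (3 / 2 - 2 / (q : ℝ))) := by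
        rw [Real.mul_rpow (by norm_num) (by positivity), ← Real.rpow_natCast, ← Real.rpow_mul
          (by linarith)]
        push_cast
        rfl
    _ ≤ 7 ^ (2 : ℝ) * (r : ℝ) ^ (((3 * q - 2 : ℕ) : ℝ)) := by
        gcongr
        · norm_num
        · linarith
        · rw [Nat.cast_sub (by omega)]
          push_cast
          have : (2 * (q : ℝ) + 1) * (3 / 2 - 2 / q) = 3 * q - 5 / 2 - 2 / q := by
            field_simp; ring
          linarith
    _ = _ := by rw [Real.rpow_natCast]; norm_num

/-- The reduction from triangle detection to EDSM is correct and fast. -/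
theorem solvesTD_reduceTo {M : Prog} {ε : ℝ} {q : ℕ} (hq : 3 ≤ q) (hε : 2 / (q : ℝ) ≤ ε)
    (hM : SolvesEDSM M fun m n N => (n : ℝ) * (m : ℝ) ^ (3 / 2 - ε) + N) :
    SolvesTD (reduceTo 6 (instanceGen q).program M) fun n => (n : ℝ) ^ (3 - (q : ℝ)⁻¹) := by
  obtain ⟨C, κ, K, h⟩ := Gen.reduceTo_exec (tokens_instanceGen q) hM
  -- The first summand pays for the work and the size of the text, the second for the term `n * m ^
  -- (3 / 2 - ε)` and the disjunction; the power of 2 stems from rounding the root up. The sign of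
  -- `K` is unknown, hence `|K|`.
  refine ⟨((C + |K|) * (36 * q + 150) + (49 * |K| + 44) * (2 * (q + 2) + 5)) * 2 ^ (3 * q - 1), κ,
    fun n A B C' hn w hw => ?_⟩
  obtain ⟨x, hxn, hx⟩ := exists_root hn (show q ≠ 0 by omega)
  have hpow : (x + 1) * (x + 1) ^ (q - 1) = (x + 1) ^ q := by
    rw [← pow_succ']; congr 1; omega
  have hmap : templateMap (template q) [rows A, rows B, rows C'] =
      instantiate (fun p => (letters [rows A, rows B, rows C']).getD p 0) (template q n) := by
    rw [templateMap, order_rows]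
  rw [template_eq hxn hx, ← hpow, instantiate_blockTemplate] at hmap
  have hr : 0 < x + 1 := Nat.succ_pos x
  have hb : 0 < (x + 1) ^ (q - 1) := Nat.pow_pos hr
  have hD : (x + 1) * (x + 1) ^ (q - 1) * (x + 1) * (x + 1) = (x + 1) ^ (q + 2) := by
    rw [hpow]; ring
  obtain ⟨σ, t, e, o, ht⟩ := h _ _ _ hmap (isInstance_text hr hb (by omega) _ _ _) w hw
  rw [exists_occEndsAt_text_iff hr hb hD,
    exists_triangle_iff A B C' (show n ≤ _ by rw [hpow]; omega)] at o
  refine ⟨σ, t, e, o, ht.trans ?_⟩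
  have hN := textSize_le_work hmap
  rw [order_rows] at hN ht ⊢
  have hW := work_instanceGen_le hq hxn hx
  set r := x + 1
  set U := r ^ (3 * q - 1)
  have hU : (U : ℝ) ≤ 2 ^ (3 * q - 1) * (n : ℝ) ^ (3 - (q : ℝ)⁻¹) := root_pow_le hq hn hx.1
  have hm := length_pattern_rpow_le hq hε hr
  rw [length_text] at ht ⊢
  set m := (pattern r (r ^ (q - 1)) (r ^ (q + 2))).length
  set N := textSize _
  have hW' : ((instanceGen q).work [n] : ℝ) ≤ (36 * q + 150) * U := by exact_mod_cast hW
  have hN' : (N : ℝ) ≤ (36 * q + 150) * U := le_trans (by exact_mod_cast hN) hW'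
  have hlen : (((2 * (q + 2) * r + 5 : ℕ)) : ℝ) ≤ (2 * (q + 2) + 5) * r := by
    push_cast
    have : (1 : ℝ) ≤ r := by exact_mod_cast hr
    linarith
  have hU1 : (1 : ℝ) ≤ U := by exact_mod_cast (Nat.pow_pos hr : 0 < r ^ (3 * q - 1))
  have hrU : (r : ℝ) ≤ U := by exact_mod_cast Nat.le_self_pow (by omega) r
  have hprod : (((2 * (q + 2) * r + 5 : ℕ)) : ℝ) * (m : ℝ) ^ (3 / 2 - ε) ≤
      49 * (2 * (q + 2) + 5) * U := by
    calc _ ≤ ((2 * (q + 2) + 5) * r) * (49 * (r : ℝ) ^ (3 * q - 2)) := by gcongr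
      _ = 49 * (2 * (q + 2) + 5) * (r : ℝ) ^ (3 * q - 2 + 1) := by ring
      _ = _ := by
        rw [show 3 * q - 2 + 1 = 3 * q - 1 by omega]
        simp only [U, Nat.cast_pow]
  have hK : K * ((((2 * (q + 2) * r + 5 : ℕ)) : ℝ) * (m : ℝ) ^ (3 / 2 - ε) + N) ≤
      |K| * (49 * (2 * (q + 2) + 5) * U + (36 * q + 150) * U) := by
    refine (mul_le_mul_of_nonneg_right (le_abs_self K) (by positivity)).trans ?_
    exact mul_le_mul_of_nonneg_left (add_le_add hprod hN') (abs_nonneg K)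
  have hC : (C : ℝ) * (instanceGen q).work [n] ≤ C * ((36 * q + 150) * U) :=
    mul_le_mul_of_nonneg_left hW' (Nat.cast_nonneg C)
  have hlast : 30 * (((2 * (q + 2) * r + 5 : ℕ)) : ℝ) + 14 ≤ 44 * (2 * (q + 2) + 5) * U := by
    have h1 : (2 * ((q : ℝ) + 2) + 5) * r ≤ (2 * (q + 2) + 5) * U := by gcongr
    have h2 : (1 : ℝ) ≤ (2 * (q + 2) + 5) * U :=
      one_le_mul_of_one_le_of_one_le (by linarith [(Nat.cast_nonneg q : (0 : ℝ) ≤ q)]) hU1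
    linarith
  calc _ ≤ C * ((36 * q + 150) * U) + |K| * (49 * (2 * (q + 2) + 5) * U + (36 * q + 150) * U)
        + 44 * (2 * (q + 2) + 5) * U := by linarith
    _ = ((C + |K|) * (36 * q + 150) + (49 * |K| + 44) * (2 * (q + 2) + 5)) * U := by ring
    _ ≤ ((C + |K|) * (36 * q + 150) + (49 * |K| + 44) * (2 * (q + 2) + 5)) *
        (2 ^ (3 * q - 1) * (n : ℝ) ^ (3 - (q : ℝ)⁻¹)) := by gcongr
    _ = _ := by ring

theorem transforms_instanceGen (q : ℕ) :
    Transforms (instanceGen q).program 6 (templateMap (template q)) := by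
  obtain ⟨C, κ, h⟩ := Gen.program_exec (tokens_instanceGen q)
  refine ⟨κ, fun x w hw => ?_⟩
  obtain ⟨σ, t, h1, h2, -⟩ := h x w hw
  exact ⟨σ, t, h1, h2⟩

end EDSM

theorem theorem1 (𝒮 : Set EDSM.Prog) (ε : ℝ) (hε : 0 < ε)
    (h : ∃ M, EDSM.Combinatorial 𝒮 M ∧
      EDSM.SolvesEDSM M fun m n N => (n : ℝ) * (m : ℝ) ^ (3 / 2 - ε) + N) :
    ∃ Q, EDSM.Combinatorial 𝒮 Q ∧ EDSM.IsTrulySubcubicTD Q := by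
  obtain ⟨M, hM, hsolves⟩ := h
  -- With `3 ≤ q` the matrices dominate the skipping, and `2 / ε ≤ q` lets the saving `ε` offset the
  -- `r ^ 2` block pairs per row. The price is that only `1 / q` is saved for triangles.
  obtain ⟨q, hq⟩ := exists_nat_ge (max 3 (2 / ε))
  have hq3 : 3 ≤ q := by exact_mod_cast (le_max_left _ _).trans hq
  have hq0 : (0 : ℝ) < q := by positivity
  have hqε : 2 / (q : ℝ) ≤ ε := by
    rw [div_le_comm₀ hq0 hε]
    exact (le_max_right _ _).trans hq
  exact ⟨_, .reduce (by omega) (EDSM.isLocal_templateMap _) (EDSM.transforms_instanceGen q) hM,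
    (q : ℝ)⁻¹, inv_pos.2 hq0, EDSM.solvesTD_reduceTo hq3 hqε hsolves⟩
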